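/- Fix a field $F$; $H_r$ denotes singular homology with coefficients in $F$. For a continuous $f:X\to\mathbb R$ put $X_t=f^{-1}(t)$, $X_{a,b}=f^{-1}([a,b])$, $X_{-\infty,t}=f^{-1}((-\infty,t])$, and for $\tau,\tau',\tau''\ge 0$ $$L^+_r(t;\tau)=\ker\big(H_r(X_t)\to H_r(X_{t,t+\tau})\big),\qquad L^-_r(t;\tau)=\ker\big(H_r(X_t)\to H_r(X_{t-\tau,t})\big),$$ $$l_r(t)=\dim H_r(X_t),\quad l_r^\pm(t;\tau)=\dim L_r^\pm(t;\tau),\quad e_r(t;\tau',\tau'')=\dim\big(L^-_r(t;\tau')\cap L^+_r(t;\tau'')\big).$$ For $t\le t'$, the persistence numbers of $f$ are $$\kappa_r(t)=\dim H_r(X_{-\infty,t}),\qquad \kappa_r(t,t')=\dim\ker\big(H_r(X_{-\infty,t})\to H_r(X_{-\infty,t'})\big).$$ A continuous map $f:X\to\mathbb R$ is called tame with critical values in a finite set $T\subset\mathbb R$ if (i) for each $t\notin T$ there is $\varepsilon>0$ such that $f:X_{t-\varepsilon,t+\varepsilon}\to[t-\varepsilon,t+\varepsilon]$ and the projection $X_t\times[t-\varepsilon,t+\varepsilon]\to[t-\varepsilon,t+\varepsilon]$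 are fiberwise homotopy equivalent; (ii) for each $t\in\mathbb R$ there are arbitrarily small $\varepsilon>0$ such that the inclusions of $X_t$ in $X_{t-\varepsilon,t+\varepsilon}$, in $X_{t-\varepsilon,t}$ and in $X_{t,t+\varepsilon}$ are homotopy equivalences. Let $X$ be a compact space and let $f:X\to\mathbb R$ be tame with critical values in $T=\{s_2<s_4<\dots<s_{2k}\}$, where $k\ge 0$. Suppose that $H_r(X_t)$ is finite-dimensional for all $r$ and $t$. Choose further numbers $s_1,s_3,\dots,s_{2k+1}$ with $s_1<s_2<s_3<\dots<s_{2k}<s_{2k+1}$. Below, $r\ge 0$ and all indices of $s$ lie in $\{1,\dots,2k+1\}$. Then all $H_r(X_{s_i,s_j})$ with $i\le j$, all $H_r(f^{-1}((-\infty,s_i]))$ and all $H_r(f^{-1}([s_i,\infty)))$ are finite-dimensional, and the level persistence numbers determine the persistence numbers of $f$ and of $-f$. More precisely: (a) the numbers $l_r(s_i)$ and $e_r(s_i;s_i-s_h,s_j-s_i)$, $h\le i\le j$, determine all $\dim H_r(X_{s_i,s_j})$, $i\le j$; (b) the numbers in (a) together with the numbers $l^+_r(s_i;s_j-s_i)$,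 $i\le j$ determine all the persistence numbers $\kappa_r(s_i)$ and $\kappa_r(s_i,s_j)$, $i\le j$, of $f$; (c) the numbers in (a) together with the numbers $l^-_r(s_j;s_j-s_i)$, $i\le j$ determine all the persistence numbers $\kappa_r(-s_i)=\dim H_r(f^{-1}([s_i,\infty)))$ and $\kappa_r(-s_j,-s_i)=\dim\ker\big(H_r(f^{-1}([s_j,\infty)))\to H_r(f^{-1}([s_i,\infty)))\big)$, $i\le j$, of $-f$. Here "determine" means: if $(X,f,(s_i))$ and $(Y,g,(s'_i))$ are two such data over the same field $F$ with the same $k$, and the former numbers agree for all $r$ and all admissible indices, then so do the latter. -/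

import Mathlib

universe u

open CategoryTheory Set

noncomputable section

namespace LevelPersistence

/-! ### Singular homology with field coefficients -/

/-- The singular homology `H_r(A; F)` of a topological space `A`, as an `F`-vector space. -/
abbrev Homology (F : Type u) [Field F] (r : ℕ) (A : Type u) [TopologicalSpace A] :
    ModuleCat.{u} F :=
  ((AlgebraicTopology.singularHomologyFunctor (ModuleCat.{u} F) r).obj
    (ModuleCat.of F F)).obj (TopCat.of A)

variable {X : Type u} [TopologicalSpace X]

/-- The inclusion of subspaces `A ⊆ B` as a continuous map. -/
def inclusionMap {A B : Set X} (h : A ⊆ B) : C(A, B) :=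
  ⟨Set.inclusion h, continuous_inclusion h⟩

/-- The linear map `H_r(A; F) → H_r(B; F)` induced by the inclusion `A ⊆ B`. -/
def homologyInclusion (F : Type u) [Field F] (r : ℕ) {A B : Set X} (h : A ⊆ B) :
    Homology F r A →ₗ[F] Homology F r B :=
  (((AlgebraicTopology.singularHomologyFunctor (ModuleCat.{u} F) r).obj
    (ModuleCat.of F F)).map (TopCat.ofHom (inclusionMap h))).hom

open Classical in
/-- The kernel of `H_r(A; F) → H_r(B; F)`, for subspaces `A ⊆ B`
(and, by convention, `0` when `A` is not contained in `B`). -/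
def inclusionKernel (F : Type u) [Field F] (r : ℕ) (A B : Set X) :
    Submodule F (Homology F r A) :=
  if h : A ⊆ B then LinearMap.ker (homologyInclusion F r h) else ⊥

/-! ### Levels, interlevels, sublevels -/

/-- The level `X_t = f⁻¹(t)`. -/
def level (f : X → ℝ) (t : ℝ) : Set X := f ⁻¹' {t}

/-- The interlevel `X_{a,b} = f⁻¹([a, b])`. -/
def interlevel (f : X → ℝ) (a b : ℝ) : Set X := f ⁻¹' Icc a b

/-- The sublevel `X_{-∞,t} = f⁻¹((-∞, t])`. -/
def sublevel (f : X → ℝ) (t : ℝ) : Set X := f ⁻¹' Iic t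

/-! ### Persistence numbers -/

/-- `κ_r(t) = dim H_r(X_{-∞,t})`. -/
def persistenceDim (F : Type u) [Field F] (f : X → ℝ) (r : ℕ) (t : ℝ) : ℕ :=
  Module.finrank F (Homology F r (sublevel f t))

/-- `κ_r(t, t') = dim ker (H_r(X_{-∞,t}) → H_r(X_{-∞,t'}))`, for `t ≤ t'`. -/
def persistenceKerDim (F : Type u) [Field F] (f : X → ℝ) (r : ℕ) (t t' : ℝ) : ℕ :=
  Module.finrank F (inclusionKernel F r (sublevel f t) (sublevel f t'))

/-! ### Level persistence numbers -/

/-- `L⁺_r(t; τ) = ker (H_r(X_t) → H_r(X_{t,t+τ}))`, for `0 ≤ τ`. -/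
def levelKerUp (F : Type u) [Field F] (f : X → ℝ) (r : ℕ) (t τ : ℝ) :
    Submodule F (Homology F r (level f t)) :=
  inclusionKernel F r (level f t) (interlevel f t (t + τ))

/-- `L⁻_r(t; τ) = ker (H_r(X_t) → H_r(X_{t-τ,t}))`, for `0 ≤ τ`. -/
def levelKerDown (F : Type u) [Field F] (f : X → ℝ) (r : ℕ) (t τ : ℝ) :
    Submodule F (Homology F r (level f t)) :=
  inclusionKernel F r (level f t) (interlevel f (t - τ) t)

/-- `l_r(t) = dim H_r(X_t)`. -/
def levelDim (F : Type u) [Field F] (f : X → ℝ) (r : ℕ) (t : ℝ) : ℕ :=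
  Module.finrank F (Homology F r (level f t))

/-- `l⁺_r(t; τ) = dim L⁺_r(t; τ)`. -/
def levelUpDim (F : Type u) [Field F] (f : X → ℝ) (r : ℕ) (t τ : ℝ) : ℕ :=
  Module.finrank F (levelKerUp F f r t τ)

/-- `l⁻_r(t; τ) = dim L⁻_r(t; τ)`. -/
def levelDownDim (F : Type u) [Field F] (f : X → ℝ) (r : ℕ) (t τ : ℝ) : ℕ :=
  Module.finrank F (levelKerDown F f r t τ)

/-- `e_r(t; τ', τ'') = dim (L⁻_r(t; τ') ∩ L⁺_r(t; τ''))`. -/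
def levelBothDim (F : Type u) [Field F] (f : X → ℝ) (r : ℕ) (t τ' τ'' : ℝ) : ℕ :=
  Module.finrank F (levelKerDown F f r t τ' ⊓ levelKerUp F f r t τ'' :
    Submodule F (Homology F r (level f t)))

/-! ### Tame maps -/

/-- Two spaces `p : E → B` and `q : E' → B` over `B` are fiberwise homotopy equivalent: there are
maps over `B` in both directions whose composites are homotopic over `B` to the identities. -/
def FiberwiseHomotopyEquivalent {E E' B : Type*} [TopologicalSpace E] [TopologicalSpace E']
    (p : E → B) (q : E' → B) : Prop :=
  ∃ (φ : C(E, E')) (ψ : C(E', E)),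
    (∀ x, q (φ x) = p x) ∧ (∀ y, p (ψ y) = q y) ∧
    (∃ H : (ψ.comp φ).Homotopy (ContinuousMap.id E), ∀ a x, p (H (a, x)) = p x) ∧
    (∃ K : (φ.comp ψ).Homotopy (ContinuousMap.id E'), ∀ a y, q (K (a, y)) = q y)

/-- `A ⊆ B`, and the inclusion of `A` in `B` is a homotopy equivalence. -/
def InclusionIsHomotopyEquiv (A B : Set X) : Prop :=
  ∃ (h : A ⊆ B) (e : ContinuousMap.HomotopyEquiv A B), e.toFun = inclusionMap h

/-- A continuous function `f` is tame, with all its critical values in the finite set `T`. -/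
structure IsTameWith (f : X → ℝ) (T : Set ℝ) : Prop where
  continuous : Continuous f
  finite : T.Finite
  /-- Over a neighbourhood of `t ∉ T`, the map `f` is fiberwise homotopy equivalent to the
  projection `X_t × [t - ε, t + ε] → [t - ε, t + ε]`. -/
  regular : ∀ t ∉ T, ∃ ε > 0, FiberwiseHomotopyEquivalent
    (fun x : interlevel f (t - ε) (t + ε) => f x)
    (fun y : level f t × Icc (t - ε) (t + ε) => (y.2 : ℝ))
  /-- For arbitrarily small `ε > 0`, the level `X_t` includes by homotopy equivalences in its
  two-sided neighbourhood `X_{t-ε,t+ε}` and in the one-sided ones `X_{t-ε,t}`, `X_{t,t+ε}`. -/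
  level_inclusion : ∀ t, ∀ η > 0, ∃ ε, 0 < ε ∧ ε < η ∧
    InclusionIsHomotopyEquiv (level f t) (interlevel f (t - ε) (t + ε)) ∧
    InclusionIsHomotopyEquiv (level f t) (interlevel f (t - ε) t) ∧
    InclusionIsHomotopyEquiv (level f t) (interlevel f t (t + ε))

/-- The real numbers `s_1 < s_2 < ⋯ < s_{2k+1}` interlace the critical values of the tame function
`f`: those of even index, `s_2, s_4, …, s_{2k}`, are the critical values, and those of odd index
are regular values separating them. -/
structure IsTameSequence (f : X → ℝ) (k : ℕ) (s : ℕ → ℝ) : Prop where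
  strictMonoOn : StrictMonoOn s (Icc 1 (2 * k + 1))
  tame : IsTameWith f ((fun i => s (2 * i)) '' Icc 1 k)

end LevelPersistence

end

open LevelPersistence

/-!
The space `X_{a,c}` is the union of `X_{a,b}` and `X_{b,c}`, which meet in the level `X_b`. The
Mayer–Vietoris sequence of this square gives everything. The kernel of
`H_r(X_b) → H_r(X_{a,b}) ⊕ H_r(X_{b,c})` is `L⁻_r(b; b - a) ∩ L⁺_r(b; c - b)`, so that
`dim H_r(X_{a,c}) = dim H_r(X_{a,b}) + dim H_r(X_{b,c}) - (l_r(b) - e_r) + e_{r-1}`,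
with `e_r = e_r(b; b - a, c - b)`. By tameness, the interlevel between two consecutive values `s_i`,
`s_{i+1}` has the homology of the level over the one that is critical, and so the dimensions
for all interlevels follow by induction (`finrank_interlevel_eq`).

By compactness the extreme values of `f` are critical, since near a regular value `f` takes values
on both sides. Hence the sublevels and superlevels at `s_i` are the interlevels `X_{s_1,s_i}` and
`X_{s_i,s_{2k+1}}`. By the same sequence, the kernel of
`H_r(X_{a,b}) → H_r(X_{a,c})` is the image of `L⁺_r(b; c - b)` in `H_r(X_{a,b})`, hence has
dimension `l⁺_r(b; c - b) - e_r(b; b - a, c - b)`; and symmetrically for `-f`.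

The Mayer–Vietoris sequence is first proved for subspaces whose interiors cover
(`isMayerVietoris_of_isOpen`). This rests on the theorem on small simplices
(`exists_sub_d_mem_smallChains`). The homotopy `T` between the identity and barycentric subdivision
is defined by recursion on affine simplices, `T[v] = b·([v] - T∂[v])` with `b` the barycenter of
`v`, and carried to singular simplices by naturality; subdivision shrinks affine simplices of
dimension `m` by the factor `m / (m + 1)`. For interlevels that meet in a level only, the level is
thickened by means of tameness (`IsHomologicallyTame.isMayerVietoris`).
-/

namespace LevelPersistence

noncomputable section

/-! ### Singular chains and their basis -/

section Chains

variable (F : Type u) [Field F]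

/-- The singular chain complex of `A` with coefficients in `F`. -/
abbrev chains (A : Type u) [TopologicalSpace A] : ChainComplex (ModuleCat.{u} F) ℕ :=
  ((AlgebraicTopology.singularChainComplexFunctor (ModuleCat.{u} F)).obj
    (ModuleCat.of F F)).obj (TopCat.of A)

/-- The chain map induced by a continuous map. -/
abbrev chainsMap {A B : Type u} [TopologicalSpace A] [TopologicalSpace B] (φ : C(A, B)) :
    chains F A ⟶ chains F B :=
  ((AlgebraicTopology.singularChainComplexFunctor (ModuleCat.{u} F)).obj
    (ModuleCat.of F F)).map (TopCat.ofHom φ)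

/-- The standard topological simplex of dimension `n`. -/
abbrev Simplex (n : ℕ) : Type := stdSimplex ℝ (Fin (n + 1))

/-- The inclusion of the `i`-th face. -/
def faceMap {n : ℕ} (i : Fin (n + 2)) : C(Simplex n, Simplex (n + 1)) :=
  ⟨stdSimplex.map i.succAbove, stdSimplex.continuous_map _⟩

variable {A B : Type u} [TopologicalSpace A] [TopologicalSpace B]

/-- A singular simplex, as a chain: the image of `1` in its summand `F` of the coproduct that
defines the singular chains. -/
def singularSimplex {n : ℕ} (σ : C(Simplex n, A)) : (chains F A).X n :=
  (SSet.ιChainComplex (TopCat.toSSet.obj (TopCat.of A)) (R := ModuleCat.of F F)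
    (((TopCat.of A).toSSetObjEquiv (.op (.mk n))).symm σ)).hom (1 : F)

lemma chainsMap_singularSimplex {n : ℕ} (φ : C(A, B)) (σ : C(Simplex n, A)) :
    ((chainsMap F φ).f n).hom (singularSimplex F σ) = singularSimplex F (φ.comp σ) := by
  have := congrArg (fun h => ModuleCat.Hom.hom h (1 : F)) (SSet.ι_chainComplexMap_f _ _
    (TopCat.toSSet.map (TopCat.ofHom φ)) (ModuleCat.of F F)
    (((TopCat.of A).toSSetObjEquiv (.op (.mk n))).symm σ))
  exact this

lemma d_singularSimplex {n : ℕ} (σ : C(Simplex (n + 1), A)) :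
    ((chains F A).d (n + 1) n).hom (singularSimplex F σ) =
      ∑ i : Fin (n + 2), (-1 : F) ^ (i : ℕ) • singularSimplex F (σ.comp (faceMap i)) := by
  have := congrArg (fun h => h.hom (1 : F)) (SSet.ιChainComplex_d (R := ModuleCat.of F F)
    (X := TopCat.toSSet.obj (TopCat.of A))
    (((TopCat.of A).toSSetObjEquiv (.op (.mk (n+1)))).symm σ))
  refine this.trans ?_
  simp only [ModuleCat.hom_sum, LinearMap.sum_apply]
  refine Finset.sum_congr rfl fun i _ => ?_
  have h : ((-1 : F) ^ (i : ℕ)) = (((-1 : ℤ) ^ (i : ℕ) : ℤ) : F) := by push_cast; rfl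
  rw [h, Int.cast_smul_eq_zsmul]
  rfl

lemma chains_hom_ext {n : ℕ} {M : Type u} [AddCommGroup M] [Module F M]
    {g h : (chains F A).X n →ₗ[F] M}
    (hgh : ∀ σ : C(Simplex n, A), g (singularSimplex F σ) = h (singularSimplex F σ)) : g = h := by
  have : ModuleCat.ofHom g = ModuleCat.ofHom h := by
    refine SSet.chainComplex_hom_ext (X := TopCat.toSSet.obj (TopCat.of A))
      (R := ModuleCat.of F F) fun x => ?_
    ext
    obtain ⟨σ, rfl⟩ := ((TopCat.of A).toSSetObjEquiv (.op (.mk n))).symm.surjective x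
    exact hgh σ
  exact congrArg ModuleCat.Hom.hom this

/-- Linear maps out of the singular chains are given by their values on singular simplices. -/
lemma exists_chains_desc {n : ℕ} {M : Type u} [AddCommGroup M] [Module F M]
    (v : C(Simplex n, A) → M) :
    ∃ g : (chains F A).X n →ₗ[F] M, ∀ σ, g (singularSimplex F σ) = v σ := by
  let s : Limits.Cofan (fun (_ : (TopCat.toSSet.obj (TopCat.of A)).obj (.op (.mk n))) =>
      ModuleCat.of F F) := Limits.Cofan.mk (ModuleCat.of F M) (fun x =>
      ModuleCat.ofHom (LinearMap.toSpanSingleton F M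
        (v (((TopCat.of A).toSSetObjEquiv (.op (.mk n))) x))))
  refine ⟨(((SSet.isColimitChainComplexXCofan (TopCat.toSSet.obj (TopCat.of A))
      (ModuleCat.of F F) n).desc s).hom), fun σ => ?_⟩
  have := congrArg (fun h => h.hom (1 : F)) ((SSet.isColimitChainComplexXCofan
    (TopCat.toSSet.obj (TopCat.of A))
      (ModuleCat.of F F) n).fac s ⟨((TopCat.of A).toSSetObjEquiv (.op (.mk n))).symm σ⟩)
  refine this.trans ?_
  simp [s]

/-- The singular simplices form a basis of the singular chains. -/
lemma exists_basis (n : ℕ) : ∃ b : Module.Basis C(Simplex n, A) F ((chains F A).X n),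
    ∀ σ, b σ = singularSimplex F σ := by
  obtain ⟨g, hg⟩ := exists_chains_desc F (A := A) (n := n)
    (fun σ => ULift.up.{u} (Finsupp.single σ (1 : F)))
  let h : (C(Simplex n, A) →₀ F) →ₗ[F] (chains F A).X n :=
    Finsupp.linearCombination F (singularSimplex F)
  refine ⟨.ofRepr (.ofLinearMap (ULift.moduleEquiv.toLinearMap ∘ₗ g) h ?_ ?_), fun σ => ?_⟩
  · ext σ : 2
    simp [h, hg]
  · apply chains_hom_ext
    intro σ
    simp [h, hg]
  · simp [h]
end Chains

/-! ### Affine maps between standard simplices -/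

section Affine

variable {l m n : ℕ}

/-- The affine map between standard simplices with prescribed vertices. -/
def affineMap (v : Fin (m + 1) → Simplex n) : C(Simplex m, Simplex n) where
  toFun t := ⟨∑ i, t.1 i • (v i).1,
    (convex_stdSimplex ℝ (Fin (n + 1))).sum_mem (fun i _ => t.2.1 i) t.2.2 fun i _ => (v i).2⟩
  continuous_toFun := by
    refine Continuous.subtype_mk ?_ _
    refine continuous_finsetSum _ fun i _ => ?_
    exact ((continuous_apply i).comp continuous_subtype_val).smul continuous_const

lemma affineMap_coe (v : Fin (m + 1) → Simplex n) (t : Simplex m) :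
    (affineMap v t).1 = ∑ i, t.1 i • (v i).1 := rfl

lemma affineMap_comp (w : Fin (m + 1) → Simplex n) (v : Fin (l + 1) → Simplex m) :
    (affineMap w).comp (affineMap v) = affineMap (affineMap w ∘ v) := by
  ext t : 1
  apply Subtype.ext
  have h (i : Fin (m + 1)) : (affineMap v t).1 i = ∑ j, t.1 j * (v j).1 i := by
    rw [affineMap_coe, Finset.sum_apply]
    rfl
  simp only [ContinuousMap.comp_apply, affineMap_coe w, affineMap_coe (affineMap w ∘ v),
    Function.comp_apply, h, Finset.sum_smul, Finset.smul_sum, mul_smul]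
  exact Finset.sum_comm

lemma affineMap_comp_faceMap (v : Fin (m + 2) → Simplex n) (i : Fin (m + 2)) :
    (affineMap v).comp (faceMap i) = affineMap (v ∘ i.succAbove) := by
  ext t : 1
  apply Subtype.ext
  have h (j : Fin (m + 2)) :
      (faceMap i t).1 j = ∑ k with i.succAbove k = j, t.1 k := by
    change (stdSimplex.map i.succAbove t : Fin (m + 2) → ℝ) j = _
    rw [stdSimplex.map_coe, FunOnFinite.linearMap_apply_apply]
    rfl
  simp only [ContinuousMap.comp_apply, affineMap_coe, Function.comp_apply]
  rw [Fin.sum_univ_succAbove _ i]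
  have h0 : (faceMap i t).1 i = 0 := by
    rw [h, Finset.sum_eq_zero]
    intro k hk
    exact absurd (Finset.mem_filter.1 hk).2 (Fin.succAbove_ne i k)
  have h1 (k : Fin (m + 1)) : (faceMap i t).1 (i.succAbove k) = t.1 k := by
    rw [h, Finset.sum_eq_single k] <;> simp +contextual
  simp only [h0, h1, zero_smul, zero_add]

lemma affineMap_vertex :
    affineMap (stdSimplex.vertex (S := ℝ)) = ContinuousMap.id (Simplex n) := by
  ext t : 1
  apply Subtype.ext
  funext j
  rw [affineMap_coe, Finset.sum_apply]
  change ∑ c, t.1 c * (stdSimplex.vertex (S := ℝ) c : Fin (n + 1) → ℝ) j = _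
  simp [Pi.single_apply]

lemma affineMap_apply_vertex (v : Fin (m + 1) → Simplex n) (i : Fin (m + 1)) :
    affineMap v (stdSimplex.vertex i) = v i := by
  apply Subtype.ext
  simp [affineMap_coe]

/-- The barycenter of the affine simplex with vertices `v`, as the image of the barycenter of the
standard simplex, which makes it compatible with affine maps. -/
def center (v : Fin (m + 1) → Simplex n) : Simplex n := affineMap v stdSimplex.barycenter

lemma affineMap_center (w : Fin (m + 1) → Simplex n) (v : Fin (l + 1) → Simplex m) :
    affineMap w (center v) = center (affineMap w ∘ v) := by
  rw [center, center, ← affineMap_comp]; rfl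

lemma dist_affineMap_le (v : Fin (m + 1) → Simplex n) (t : Simplex m) (c : Simplex n) (r : ℝ)
    (h : ∀ i, dist c (v i) ≤ r) : dist c (affineMap v t) ≤ r := by
  rw [dist_comm]
  refine (convex_closedBall c.1 r).sum_mem (fun i _ => t.2.1 i) t.2.2 fun i _ => ?_
  rw [Metric.mem_closedBall, dist_comm]
  exact h i

/-- The barycenter of a simplex of diameter at most `D` has distance at most `m / (m + 1) * D`
from the vertices. -/
lemma dist_center_le (v : Fin (m + 1) → Simplex n) (D : ℝ)
    (h : ∀ i j, dist (v i) (v j) ≤ D) (j : Fin (m + 1)) :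
    dist (center v) (v j) ≤ m / (m + 1) * D := by
  have hm : (0 : ℝ) < m + 1 := by positivity
  have hb (i : Fin (m + 1)) :
      (stdSimplex.barycenter : stdSimplex ℝ (Fin (m + 1))).1 i = (m + 1 : ℝ)⁻¹ := by
    refine (stdSimplex.barycenter_apply (𝕜 := ℝ) i).trans ?_
    simp
  have hs : (center v).1 - (v j).1 = ∑ i, (m + 1 : ℝ)⁻¹ • ((v i).1 - (v j).1) := by
    rw [center, affineMap_coe]
    simp only [hb, smul_sub, Finset.sum_sub_distrib, Finset.sum_const, Finset.card_univ,
      Fintype.card_fin, ← Nat.cast_smul_eq_nsmul ℝ, smul_smul]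
    push_cast
    rw [mul_inv_cancel₀ hm.ne', one_smul]
  rw [Subtype.dist_eq, dist_eq_norm, hs, Fin.sum_univ_succAbove _ j, sub_self, smul_zero, zero_add]
  refine (norm_sum_le_of_le (f := fun i => (m + 1 : ℝ)⁻¹ • ((v (j.succAbove i)).1 - (v j).1))
    (n := fun _ => (m + 1 : ℝ)⁻¹ * D) _ fun i _ => ?_).trans ?_
  · rw [norm_smul, norm_inv, Real.norm_of_nonneg hm.le, ← dist_eq_norm]
    gcongr
    exact h _ _
  · simp only [Finset.sum_const, Finset.card_univ, Fintype.card_fin, nsmul_eq_mul]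
    apply le_of_eq
    ring

end Affine

/-! ### Barycentric subdivision of ordered chains -/

section OrderedChains

variable (F : Type u) [Field F] (V W : Type) {m n : ℕ}

/-- Ordered chains of degree `m`: formal linear combinations of `(m + 1)`-tuples of vertices, which
may be degenerate. -/
abbrev OrderedChains (m : ℕ) : Type u := (Fin (m + 1) → V) →₀ F

/-- The boundary of an ordered chain. -/
def boundary (m : ℕ) : OrderedChains F V (m + 1) →ₗ[F] OrderedChains F V m :=
  Finsupp.linearCombination F fun v =>
    ∑ i : Fin (m + 2), (-1 : F) ^ (i : ℕ) • Finsupp.single (v ∘ i.succAbove) 1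

variable {V W}

variable {F} in
/-- Statements that are compatible with linear combinations need only be checked on tuples. -/
lemma orderedChains_induction {p : OrderedChains F V m → Prop}
    (h0 : p 0) (hadd : ∀ x y, p x → p y → p (x + y)) (hsmul : ∀ (a : F) x, p x → p (a • x))
    (hsingle : ∀ w, p (Finsupp.single w 1)) (c : OrderedChains F V m) : p c := by
  induction c using Finsupp.induction_linear with
  | zero => exact h0
  | add x y hx hy => exact hadd x y hx hy
  | single v a =>
    rw [← mul_one a, ← smul_eq_mul, ← Finsupp.smul_single]
    exact hsmul _ _ (hsingle v)

/-- The cone with apex `b` over an ordered chain. -/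
def cone (b : V) (m : ℕ) : OrderedChains F V m →ₗ[F] OrderedChains F V (m + 1) :=
  Finsupp.lmapDomain F F (Fin.cons b : _ → Fin (m + 2) → V)

/-- The map of ordered chains induced by a map of vertices. -/
def pushforward (φ : V → W) (m : ℕ) : OrderedChains F V m →ₗ[F] OrderedChains F W m :=
  Finsupp.lmapDomain F F (φ ∘ ·)

lemma boundary_single (v : Fin (m + 2) → V) :
    boundary F V m (Finsupp.single v 1) =
      ∑ i : Fin (m + 2), (-1 : F) ^ (i : ℕ) • Finsupp.single (v ∘ i.succAbove) 1 := by
  simp [boundary]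

lemma cone_single (b : V) (v : Fin (m + 1) → V) (a : F) :
    cone F b m (Finsupp.single v a) = Finsupp.single (Fin.cons b v : Fin (m + 2) → V) a := by
  simp [cone]

lemma pushforward_single (φ : V → W) (v : Fin (m + 1) → V) (a : F) :
    pushforward F φ m (Finsupp.single v a) = Finsupp.single (φ ∘ v) a := by
  simp [pushforward]

/-- The cone is a contracting homotopy in positive degrees. (In degree zero, the apex enters.) -/
lemma boundary_cone (b : V) (c : OrderedChains F V (m + 1)) :
    boundary F V (m + 1) (cone F b (m + 1) c) = c - cone F b m (boundary F V m c) := by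
  induction c using orderedChains_induction with
  | h0 => simp
  | hadd x y hx hy => simp only [map_add, hx, hy]; abel
  | hsmul a x hx => simp only [map_smul, hx, smul_sub]
  | hsingle v =>
    rw [cone_single, boundary_single, boundary_single, Fin.sum_univ_succ]
    simp only [map_sum, map_smul, cone_single, Fin.val_zero, pow_zero, one_smul, Fin.val_succ,
      pow_succ, mul_neg_one, neg_smul, Finset.sum_neg_distrib, sub_eq_add_neg]
    have h0 : (Fin.cons b v : Fin (m + 3) → V) ∘ (0 : Fin (m + 3)).succAbove = v := by
      ext i; simp
    rw [h0]
    congr 2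
    refine Finset.sum_congr rfl fun i _ => ?_
    congr 2
    ext j
    refine Fin.cases ?_ (fun j => ?_) j
    · simp
    · simp

/-- Each tuple is a cone, so that this follows by induction from `boundary_cone`. -/
lemma boundary_boundary (c : OrderedChains F V (m + 2)) :
    boundary F V m (boundary F V (m + 1) c) = 0 := by
  induction m with
  | zero =>
    induction c using orderedChains_induction with
    | h0 => simp
    | hadd x y hx hy => simp only [map_add, hx, hy, add_zero]
    | hsmul a x hx => simp only [map_smul, hx, smul_zero]
    | hsingle v =>
      obtain ⟨b, w, rfl⟩ : ∃ b w, v = (Fin.cons b w : Fin 3 → V) :=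
        ⟨v 0, Fin.tail v, (Fin.cons_self_tail v).symm⟩
      rw [← cone_single, boundary_cone, map_sub, boundary_single]
      simp [Fin.sum_univ_succ, cone_single, boundary_single]
      have h : Fin.tail (w ∘ Fin.succ) = Fin.tail (w ∘ Fin.succAbove 1) :=
        Subsingleton.elim (α := Fin 0 → V) _ _
      rw [h]
      abel
  | succ m ih =>
    induction c using orderedChains_induction with
    | h0 => simp
    | hadd x y hx hy => simp only [map_add, hx, hy, add_zero]
    | hsmul a x hx => simp only [map_smul, hx, smul_zero]
    | hsingle v =>
      obtain ⟨b, w, rfl⟩ : ∃ b w, v = (Fin.cons b w : Fin (m + 4) → V) :=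
        ⟨v 0, Fin.tail v, (Fin.cons_self_tail v).symm⟩
      rw [← cone_single, boundary_cone, map_sub, boundary_cone, ih]
      simp

lemma boundary_pushforward (φ : V → W) (c : OrderedChains F V (m + 1)) :
    boundary F W m (pushforward F φ (m + 1) c) = pushforward F φ m (boundary F V m c) := by
  induction c using orderedChains_induction with
  | h0 => simp
  | hadd x y hx hy => simp only [map_add, hx, hy]
  | hsmul a x hx => simp only [map_smul, hx]
  | hsingle v =>
    simp only [map_smul, pushforward_single, boundary_single, map_sum]
    rfl

lemma pushforward_cone (φ : V → W) (b : V) (c : OrderedChains F V m) :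
    pushforward F φ (m + 1) (cone F b m c) = cone F (φ b) m (pushforward F φ m c) := by
  induction c using orderedChains_induction with
  | h0 => simp
  | hadd x y hx hy => simp only [map_add, hx, hy]
  | hsmul a x hx => simp only [map_smul, hx]
  | hsingle v =>
    simp only [pushforward_single, cone_single]
    congr 1
    ext j : 1
    refine Fin.cases ?_ (fun j => ?_) j <;> simp

variable (n)

/-- Barycentric subdivision of ordered chains in a standard simplex: the cone, from the barycenter,
over the subdivision of the boundary. -/
def subdiv : (m : ℕ) → OrderedChains F (Simplex n) m →ₗ[F] OrderedChains F (Simplex n) m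
  | 0 => LinearMap.id
  | m + 1 => Finsupp.linearCombination F fun v =>
      cone F (center v) m (subdiv m (boundary F _ m (Finsupp.single v 1)))

/-- The chain homotopy `T` between the identity and barycentric subdivision, given recursively by
`T[v] = b·([v] - T∂[v])`, where `b` is the barycenter of `v`. It vanishes in degree zero, where
subdivision is the identity. -/
def subdivHomotopy :
    (m : ℕ) → OrderedChains F (Simplex n) m →ₗ[F] OrderedChains F (Simplex n) (m + 1)
  | 0 => 0
  | m + 1 => Finsupp.linearCombination F fun v =>
      cone F (center v) (m + 1)
        (Finsupp.single v 1 - subdivHomotopy m (boundary F _ m (Finsupp.single v 1)))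

variable {n}

lemma subdiv_single (v : Fin (m + 2) → Simplex n) :
    subdiv F n (m + 1) (Finsupp.single v 1) =
      cone F (center v) m (subdiv F n m (boundary F _ m (Finsupp.single v 1))) := by
  simp [subdiv]

lemma subdivHomotopy_single (v : Fin (m + 2) → Simplex n) :
    subdivHomotopy F n (m + 1) (Finsupp.single v 1) = cone F (center v) (m + 1)
        (Finsupp.single v 1 - subdivHomotopy F n m (boundary F _ m (Finsupp.single v 1))) := by
  simp [subdivHomotopy]

/-- `∂T + T∂ = 1 - Sd`, by induction on the degree and the cone formula. -/
lemma boundary_subdivHomotopy (c : OrderedChains F (Simplex n) (m + 1)) :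
    boundary F _ (m + 1) (subdivHomotopy F n (m + 1) c) +
      subdivHomotopy F n m (boundary F _ m c) = c - subdiv F n (m + 1) c := by
  induction m with
  | zero =>
    induction c using orderedChains_induction with
    | h0 => simp
    | hadd x y hx hy =>
      simp only [map_add] at *
      rw [add_add_add_comm, hx, hy, sub_add_sub_comm]
    | hsmul a x hx => simp only [map_smul, ← smul_add, hx, smul_sub]
    | hsingle v =>
      rw [subdivHomotopy_single, boundary_cone, subdiv_single]
      simp [subdivHomotopy, subdiv]
  | succ m ih =>
    induction c using orderedChains_induction with
    | h0 => simp
    | hadd x y hx hy =>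
      simp only [map_add] at *
      rw [add_add_add_comm, hx, hy, sub_add_sub_comm]
    | hsmul a x hx => simp only [map_smul, ← smul_add, hx, smul_sub]
    | hsingle v =>
      rw [subdivHomotopy_single, boundary_cone, subdiv_single, map_sub]
      have := ih (boundary F _ (m + 1) (Finsupp.single v 1))
      rw [boundary_boundary, map_zero, add_zero] at this
      rw [this, sub_sub_cancel]
      abel_nf

lemma subdiv_pushforward {l : ℕ} (w : Fin (l + 1) → Simplex n)
    (c : OrderedChains F (Simplex l) m) :
    subdiv F n m (pushforward F (affineMap w) m c) =
      pushforward F (affineMap w) m (subdiv F l m c) := by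
  induction m with
  | zero => rfl
  | succ m ih =>
    induction c using orderedChains_induction with
    | h0 => simp
    | hadd x y hx hy => simp only [map_add, hx, hy]
    | hsmul a x hx => simp only [map_smul, hx]
    | hsingle v =>
      rw [subdiv_single, pushforward_cone, ← ih, ← boundary_pushforward, pushforward_single,
        subdiv_single, affineMap_center]

lemma subdivHomotopy_pushforward {l : ℕ} (w : Fin (l + 1) → Simplex n)
    (c : OrderedChains F (Simplex l) m) :
    subdivHomotopy F n m (pushforward F (affineMap w) m c) =
      pushforward F (affineMap w) (m + 1) (subdivHomotopy F l m c) := by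
  induction m with
  | zero => simp [subdivHomotopy]
  | succ m ih =>
    induction c using orderedChains_induction with
    | h0 => simp
    | hadd x y hx hy => simp only [map_add, hx, hy]
    | hsmul a x hx => simp only [map_smul, hx]
    | hsingle v =>
      rw [subdivHomotopy_single, pushforward_cone, map_sub, ← ih, ← boundary_pushforward,
        pushforward_single, subdivHomotopy_single, affineMap_center]

/-- The simplices of the subdivision of `v` lie in every ball around the vertices of `v`, and their
diameters are smaller by a factor `m / (m + 1)`. -/
lemma subdiv_mem_supported (v : Fin (m + 1) → Simplex n) (D : ℝ)
    (hD : ∀ i j, dist (v i) (v j) ≤ D) :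
    subdiv F n m (Finsupp.single v 1) ∈ Finsupp.supported F F
      {w | (∀ c r, (∀ i, dist c (v i) ≤ r) → ∀ i, dist c (w i) ≤ r) ∧
        ∀ i j, dist (w i) (w j) ≤ m / (m + 1) * D} := by
  induction m generalizing D with
  | zero =>
    refine Finsupp.single_mem_supported F 1 ⟨fun c r h => h, fun i j => ?_⟩
    simp [Subsingleton.elim (α := Fin 1) i j]
  | succ m ih =>
    have hD0 : 0 ≤ D := dist_nonneg.trans (hD 0 0)
    rw [subdiv_single, boundary_single]
    simp only [map_sum, map_smul]
    refine Submodule.sum_mem _ fun i _ => Submodule.smul_mem _ _ ?_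
    have h := ih (v ∘ i.succAbove) D fun _ _ => hD _ _
    have hm : (m : ℝ) / (m + 1) ≤ (m + 1 : ℕ) / ((m + 1 : ℕ) + 1) := by
      push_cast
      rw [div_le_div_iff₀ (by positivity) (by positivity)]
      nlinarith
    refine (Finsupp.mem_supported _ _).2 fun w hw => ?_
    -- the simplices of the cone are `Fin.cons (center v) w`, with `w` in the subdivision of a face
    obtain ⟨w, hw', rfl⟩ := Finset.mem_image.1 (Finsupp.mapDomain_support hw)
    obtain ⟨hw1, hw2⟩ := (Finsupp.mem_supported _ _).1 h hw'
    have hcw (j) : dist (center v) (w j) ≤ (m + 1 : ℕ) / ((m + 1 : ℕ) + 1) * D :=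
      hw1 _ _ (fun i => dist_center_le v D hD _) j
    constructor
    · intro c r hc j
      refine Fin.cases ?_ (fun j => ?_) j
      · exact dist_affineMap_le v _ c r hc
      · exact hw1 c r (fun i => hc _) j
    · intro j k
      have h0 : 0 ≤ ((m + 1 : ℕ) : ℝ) / ((m + 1 : ℕ) + 1) * D := by positivity
      refine Fin.cases ?_ (fun j => ?_) j <;> refine Fin.cases ?_ (fun k => ?_) k
      · simpa using h0
      · exact hcw k
      · rw [dist_comm]; exact hcw j
      · exact (hw2 j k).trans (by gcongr)

/-- The diameters of the simplices of the `k`-fold subdivision of `v` are at most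
`(m / (m + 1)) ^ k` times the one of `v`. -/
lemma subdiv_iterate_mem_supported (v : Fin (m + 1) → Simplex n) (D : ℝ)
    (hD : ∀ i j, dist (v i) (v j) ≤ D) (k : ℕ) :
    (subdiv F n m)^[k] (Finsupp.single v 1) ∈ Finsupp.supported F F
      {w | ∀ i j, dist (w i) (w j) ≤ (m / (m + 1)) ^ k * D} := by
  induction k with
  | zero => exact Finsupp.single_mem_supported F 1 (by simpa using hD)
  | succ k ih =>
    rw [Function.iterate_succ_apply']
    generalize (subdiv F n m)^[k] (Finsupp.single v 1) = c at ih
    rw [← Finsupp.sum_single c, Finsupp.sum, map_sum]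
    refine Submodule.sum_mem _ fun w hw => ?_
    rw [← mul_one (c w), ← smul_eq_mul (c w), ← Finsupp.smul_single, map_smul]
    refine Submodule.smul_mem _ _ ?_
    refine Finsupp.supported_mono ?_
      (subdiv_mem_supported F w _ ((Finsupp.mem_supported _ _).1 ih hw))
    rintro w' ⟨-, h⟩ i j
    refine (h i j).trans (le_of_eq ?_)
    ring

end OrderedChains

/-! ### Subdivision of singular chains and small simplices -/

section SmallSimplices

variable (F : Type u) [Field F] {X Y : Type u} [TopologicalSpace X] [TopologicalSpace Y] {m n : ℕ}

/-- The chain map from ordered chains in the standard simplex to singular chains that sends a tuple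
`w` to the restriction of `σ` to the affine simplex with vertices `w`. -/
def simplexChains (σ : C(Simplex n, X)) (m : ℕ) :
    OrderedChains F (Simplex n) m →ₗ[F] (chains F X).X m :=
  Finsupp.linearCombination F fun w => singularSimplex F (σ.comp (affineMap w))

lemma simplexChains_single (σ : C(Simplex n, X)) (w : Fin (m + 1) → Simplex n) :
    simplexChains F σ m (Finsupp.single w 1) = singularSimplex F (σ.comp (affineMap w)) := by
  simp [simplexChains]

lemma simplexChains_vertex (σ : C(Simplex n, X)) :
    simplexChains F σ n (Finsupp.single stdSimplex.vertex 1) = singularSimplex F σ := by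
  rw [simplexChains_single, affineMap_vertex, ContinuousMap.comp_id]

lemma d_simplexChains (σ : C(Simplex n, X)) (c : OrderedChains F (Simplex n) (m + 1)) :
    ((chains F X).d (m + 1) m).hom (simplexChains F σ (m + 1) c) =
      simplexChains F σ m (boundary F _ m c) := by
  induction c using orderedChains_induction with
  | h0 => simp
  | hadd x y hx hy => simp only [map_add, hx, hy]
  | hsmul a x hx => simp only [map_smul, hx]
  | hsingle w =>
    simp only [simplexChains_single, d_singularSimplex, boundary_single, map_sum, map_smul,
      ContinuousMap.comp_assoc, affineMap_comp_faceMap]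

lemma chainsMap_simplexChains (φ : C(X, Y)) (σ : C(Simplex n, X))
    (c : OrderedChains F (Simplex n) m) :
    ((chainsMap F φ).f m).hom (simplexChains F σ m c) = simplexChains F (φ.comp σ) m c := by
  induction c using orderedChains_induction with
  | h0 => simp
  | hadd x y hx hy => simp only [map_add, hx, hy]
  | hsmul a x hx => simp only [map_smul, hx]
  | hsingle w =>
    simp only [simplexChains_single, chainsMap_singularSimplex, ContinuousMap.comp_assoc]

lemma simplexChains_comp_affineMap (σ : C(Simplex n, X)) {l : ℕ} (w : Fin (l + 1) → Simplex n)
    (c : OrderedChains F (Simplex l) m) :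
    simplexChains F (σ.comp (affineMap w)) m c =
      simplexChains F σ m (pushforward F (affineMap w) m c) := by
  induction c using orderedChains_induction with
  | h0 => simp
  | hadd x y hx hy => simp only [map_add, hx, hy]
  | hsmul a x hx => simp only [map_smul, hx]
  | hsingle w =>
    simp only [simplexChains_single, pushforward_single, ContinuousMap.comp_assoc, affineMap_comp]

variable (X) in
/-- Barycentric subdivision of singular chains: the image under `σ` of the subdivision of the
standard simplex. -/
def chainsSubdiv (m : ℕ) : (chains F X).X m →ₗ[F] (chains F X).X m :=
  (exists_chains_desc F fun σ : C(Simplex m, X) =>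
    simplexChains F σ m (subdiv F m m (Finsupp.single stdSimplex.vertex 1))).choose

variable (X) in
/-- The natural homotopy between the identity and barycentric subdivision of singular chains. -/
def chainsHomotopy (m : ℕ) : (chains F X).X m →ₗ[F] (chains F X).X (m + 1) :=
  (exists_chains_desc F fun σ : C(Simplex m, X) =>
    simplexChains F σ (m + 1) (subdivHomotopy F m m (Finsupp.single stdSimplex.vertex 1))).choose

lemma chainsSubdiv_singularSimplex (σ : C(Simplex m, X)) :
    chainsSubdiv F X m (singularSimplex F σ) =
      simplexChains F σ m (subdiv F m m (Finsupp.single stdSimplex.vertex 1)) :=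
  (exists_chains_desc F fun σ : C(Simplex m, X) =>
    simplexChains F σ m (subdiv F m m (Finsupp.single stdSimplex.vertex 1))).choose_spec σ

lemma chainsHomotopy_singularSimplex (σ : C(Simplex m, X)) :
    chainsHomotopy F X m (singularSimplex F σ) =
      simplexChains F σ (m + 1) (subdivHomotopy F m m (Finsupp.single stdSimplex.vertex 1)) :=
  (exists_chains_desc F fun σ : C(Simplex m, X) => simplexChains F σ (m + 1)
    (subdivHomotopy F m m (Finsupp.single stdSimplex.vertex 1))).choose_spec σ

lemma pushforward_vertex (w : Fin (m + 1) → Simplex n) :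
    pushforward F (affineMap w) m (Finsupp.single stdSimplex.vertex 1) = Finsupp.single w 1 := by
  rw [pushforward_single]
  congr 1
  funext i
  exact affineMap_apply_vertex w i

lemma chainsSubdiv_simplexChains (σ : C(Simplex n, X)) (c : OrderedChains F (Simplex n) m) :
    chainsSubdiv F X m (simplexChains F σ m c) = simplexChains F σ m (subdiv F n m c) := by
  induction c using orderedChains_induction with
  | h0 => simp
  | hadd x y hx hy => simp only [map_add, hx, hy]
  | hsmul a x hx => simp only [map_smul, hx]
  | hsingle w =>
    rw [simplexChains_single, chainsSubdiv_singularSimplex, simplexChains_comp_affineMap,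
      ← subdiv_pushforward, pushforward_vertex]

lemma chainsHomotopy_simplexChains (σ : C(Simplex n, X)) (c : OrderedChains F (Simplex n) m) :
    chainsHomotopy F X m (simplexChains F σ m c) =
      simplexChains F σ (m + 1) (subdivHomotopy F n m c) := by
  induction c using orderedChains_induction with
  | h0 => simp
  | hadd x y hx hy => simp only [map_add, hx, hy]
  | hsmul a x hx => simp only [map_smul, hx]
  | hsingle w =>
    rw [simplexChains_single, chainsHomotopy_singularSimplex, simplexChains_comp_affineMap,
      ← subdivHomotopy_pushforward, pushforward_vertex]

lemma chainsHomotopy_chainsMap (φ : C(X, Y)) (z : (chains F X).X m) :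
    chainsHomotopy F Y m (((chainsMap F φ).f m).hom z) =
      ((chainsMap F φ).f (m + 1)).hom (chainsHomotopy F X m z) := by
  have : chainsHomotopy F Y m ∘ₗ ((chainsMap F φ).f m).hom =
      ((chainsMap F φ).f (m + 1)).hom ∘ₗ chainsHomotopy F X m := by
    apply chains_hom_ext
    intro σ
    simp only [LinearMap.comp_apply, chainsMap_singularSimplex, chainsHomotopy_singularSimplex,
      chainsMap_simplexChains]
  exact LinearMap.congr_fun this z

/-- `∂T + T∂ = 1 - Sd` on singular chains. -/
lemma d_chainsHomotopy (z : (chains F X).X (m + 1)) :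
    ((chains F X).d (m + 2) (m + 1)).hom (chainsHomotopy F X (m + 1) z) +
      chainsHomotopy F X m (((chains F X).d (m + 1) m).hom z) =
        z - chainsSubdiv F X (m + 1) z := by
  have : ((chains F X).d (m + 2) (m + 1)).hom ∘ₗ chainsHomotopy F X (m + 1) +
      chainsHomotopy F X m ∘ₗ ((chains F X).d (m + 1) m).hom =
        LinearMap.id - chainsSubdiv F X (m + 1) := by
    apply chains_hom_ext
    intro σ
    simp only [LinearMap.add_apply, LinearMap.comp_apply, LinearMap.sub_apply, LinearMap.id_apply]
    rw [← simplexChains_vertex, chainsHomotopy_simplexChains, d_simplexChains, d_simplexChains,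
      chainsHomotopy_simplexChains, chainsSubdiv_simplexChains, ← map_add, ← map_sub,
      boundary_subdivHomotopy]
  exact LinearMap.congr_fun this z

variable {A B : Type u} [TopologicalSpace A] [TopologicalSpace B] (φ : C(A, X)) (ψ : C(B, X))

/-- The chains that are sums of chains coming from `A` and from `B`. -/
def smallChains (m : ℕ) : Submodule F ((chains F X).X m) :=
  LinearMap.range ((chainsMap F φ).f m).hom ⊔ LinearMap.range ((chainsMap F ψ).f m).hom

variable {φ ψ}

lemma chainsHomotopy_mem_smallChains {z : (chains F X).X m} (hz : z ∈ smallChains F φ ψ m) :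
    chainsHomotopy F X m z ∈ smallChains F φ ψ (m + 1) := by
  obtain ⟨_, ⟨a, rfl⟩, _, ⟨b, rfl⟩, rfl⟩ := Submodule.mem_sup.1 hz
  rw [map_add, chainsHomotopy_chainsMap, chainsHomotopy_chainsMap]
  exact Submodule.add_mem_sup ⟨_, rfl⟩ ⟨_, rfl⟩

lemma d_mem_smallChains {z : (chains F X).X (m + 1)} (hz : z ∈ smallChains F φ ψ (m + 1)) :
    ((chains F X).d (m + 1) m).hom z ∈ smallChains F φ ψ m := by
  obtain ⟨_, ⟨a, rfl⟩, _, ⟨b, rfl⟩, rfl⟩ := Submodule.mem_sup.1 hz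
  rw [map_add]
  refine Submodule.add_mem_sup ⟨((chains F A).d (m + 1) m).hom a, ?_⟩
    ⟨((chains F B).d (m + 1) m).hom b, ?_⟩
  · exact congrArg (fun h => h.hom a) ((chainsMap F φ).comm (m + 1) m).symm
  · exact congrArg (fun h => h.hom b) ((chainsMap F ψ).comm (m + 1) m).symm

lemma singularSimplex_mem_range (hφ : Topology.IsEmbedding φ) {σ : C(Simplex m, X)}
    (h : ∀ t, σ t ∈ range φ) :
    singularSimplex F σ ∈ LinearMap.range ((chainsMap F φ).f m).hom := by
  choose τ hτ using h
  have hc : Continuous τ := by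
    rw [hφ.isInducing.continuous_iff]
    exact (continuous_congr hτ).2 σ.continuous
  refine ⟨singularSimplex F ⟨τ, hc⟩, ?_⟩
  rw [chainsMap_singularSimplex]
  congr 1
  ext t
  exact hτ t

variable (hφ : Topology.IsEmbedding φ) (hψ : Topology.IsEmbedding ψ)

include hφ hψ

/-- A singular simplex of dimension zero is a point, and so lies in `A` or in `B`. -/
lemma mem_smallChains_zero (h : range φ ∪ range ψ = univ) (z : (chains F X).X 0) :
    z ∈ smallChains F φ ψ 0 := by
  obtain ⟨b, hb⟩ := exists_basis F (A := X) 0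
  rw [← b.linearCombination_repr z]
  refine Submodule.sum_mem _ fun σ _ => Submodule.smul_mem _ _ ?_
  rw [hb]
  have hs : ∀ s t : Simplex 0, s = t := Subsingleton.elim (α := stdSimplex ℝ (Fin 1))
  have : σ default ∈ range φ ∪ range ψ := h ▸ mem_univ _
  rcases this with h | h
  · exact Submodule.mem_sup_left (singularSimplex_mem_range F hφ fun t => hs default t ▸ h)
  · exact Submodule.mem_sup_right (singularSimplex_mem_range F hψ fun t => hs default t ▸ h)

/-- Sufficiently fine subdivisions of a chain are small, by the Lebesgue number lemma for the
preimages of the interiors of `A` and `B` in the standard simplex. -/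
lemma exists_iterate_mem_smallChains (h : interior (range φ) ∪ interior (range ψ) = univ)
    (z : (chains F X).X m) :
    ∃ k, ∀ l ≥ k, (chainsSubdiv F X m)^[l] z ∈ smallChains F φ ψ m := by
  obtain ⟨b, hb⟩ := exists_basis F (A := X) m
  have key (σ : C(Simplex m, X)) :
      ∃ k, ∀ l ≥ k, (chainsSubdiv F X m)^[l] (singularSimplex F σ) ∈ smallChains F φ ψ m := by
    let c : Bool → Set (Simplex m) := fun i =>
      bif i then σ ⁻¹' interior (range φ) else σ ⁻¹' interior (range ψ)
    obtain ⟨δ, hδ, hc⟩ := lebesgue_number_lemma_of_metric (s := (univ : Set (Simplex m)))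
      isCompact_univ (c := c) (by
        rintro (_ | _)
        · exact isOpen_interior.preimage σ.continuous
        · exact isOpen_interior.preimage σ.continuous) (by
        intro t _
        have : σ t ∈ interior (range φ) ∪ interior (range ψ) := h ▸ mem_univ _
        rcases this with h | h
        · exact mem_iUnion.2 ⟨true, h⟩
        · exact mem_iUnion.2 ⟨false, h⟩)
    -- the diameters of the simplices of the subdivisions tend to zero
    have hbd : Bornology.IsBounded (univ : Set (Simplex m)) := isCompact_univ.isBounded
    obtain ⟨D, hD⟩ := Metric.isBounded_iff.1 hbd
    have hlt : (m : ℝ) / (m + 1) < 1 := by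
      rw [div_lt_one (by positivity)]; linarith
    have hlim : Filter.Tendsto (fun k : ℕ => ((m : ℝ) / (m + 1)) ^ k * D) Filter.atTop
        (nhds (0 * D)) :=
      (tendsto_pow_atTop_nhds_zero_of_lt_one (by positivity) hlt).mul_const D
    rw [zero_mul] at hlim
    obtain ⟨k, hk⟩ := Filter.eventually_atTop.1 (hlim.eventually_lt_const hδ)
    refine ⟨k, fun l hl => ?_⟩
    have hit (l : ℕ) : (chainsSubdiv F X m)^[l] (singularSimplex F σ) =
        simplexChains F σ m ((subdiv F m m)^[l] (Finsupp.single stdSimplex.vertex 1)) := by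
      induction l with
      | zero => exact (simplexChains_vertex F σ).symm
      | succ l ih =>
        rw [Function.iterate_succ_apply', Function.iterate_succ_apply', ih,
          chainsSubdiv_simplexChains]
    rw [hit]
    have hmem := subdiv_iterate_mem_supported F (stdSimplex.vertex (S := ℝ) (X := Fin (m + 1))) D
      (fun i j => hD (mem_univ _) (mem_univ _)) l
    refine Submodule.sum_mem _ fun w hw => Submodule.smul_mem _ _ ?_
    have hw := (Finsupp.mem_supported _ _).1 hmem hw
    have hball (t : Simplex m) : affineMap w t ∈ Metric.ball (w 0) δ := by
      rw [Metric.mem_ball, dist_comm]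
      exact (dist_affineMap_le w t (w 0) _ fun i => hw 0 i).trans_lt (hk l hl)
    obtain ⟨i, hi⟩ := hc (w 0) (mem_univ _)
    cases i with
    | true =>
      exact Submodule.mem_sup_left (singularSimplex_mem_range F hφ fun t =>
        interior_subset (hi (hball t)))
    | false =>
      exact Submodule.mem_sup_right (singularSimplex_mem_range F hψ fun t =>
        interior_subset (hi (hball t)))
  choose k hk using key
  refine ⟨(b.repr z).support.sup k, fun l hl => ?_⟩
  have hz := congrArg (((chainsSubdiv F X m) ^ l : Module.End F _)) (b.linearCombination_repr z)
  rw [← Module.End.pow_apply, ← hz, Finsupp.linearCombination_apply, Finsupp.sum, map_sum]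
  refine Submodule.sum_mem _ fun σ hσ => ?_
  rw [map_smul, hb, Module.End.pow_apply]
  exact Submodule.smul_mem _ _ (hk σ l ((Finset.le_sup hσ).trans hl))

/-- **The theorem on small simplices**: the singular chains modulo the small chains are acyclic. -/
lemma exists_sub_d_mem_smallChains (h : interior (range φ) ∪ interior (range ψ) = univ)
    (z : (chains F X).X (m + 1))
    (hz : ((chains F X).d (m + 1) m).hom z ∈ smallChains F φ ψ m) :
    ∃ y, z - ((chains F X).d (m + 2) (m + 1)).hom y ∈ smallChains F φ ψ (m + 1) := by
  obtain ⟨k, hk⟩ := exists_iterate_mem_smallChains F hφ hψ h z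
  have key (l : ℕ) (z : (chains F X).X (m + 1))
      (hz : ((chains F X).d (m + 1) m).hom z ∈ smallChains F φ ψ m)
      (hl : (chainsSubdiv F X (m + 1))^[l] z ∈ smallChains F φ ψ (m + 1)) :
      ∃ y, z - ((chains F X).d (m + 2) (m + 1)).hom y ∈ smallChains F φ ψ (m + 1) := by
    induction l generalizing z with
    | zero => exact ⟨0, by simpa using hl⟩
    | succ l ih =>
      -- `Sd z = z - ∂Tz - T∂z`, where `T∂z` is small
      have hs := d_chainsHomotopy F z
      have hd : ((chains F X).d (m + 1) m).hom
          (((chains F X).d (m + 2) (m + 1)).hom (chainsHomotopy F X (m + 1) z)) = 0 :=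
        congrArg (fun h => h.hom (chainsHomotopy F X (m + 1) z))
          ((chains F X).d_comp_d (m + 2) (m + 1) m)
      have hT := chainsHomotopy_mem_smallChains F hz
      have hsub : chainsSubdiv F X (m + 1) z =
          z - ((chains F X).d (m + 2) (m + 1)).hom (chainsHomotopy F X (m + 1) z) -
            chainsHomotopy F X m (((chains F X).d (m + 1) m).hom z) := by
        rw [sub_sub, hs, sub_sub_cancel]
      obtain ⟨y, hy⟩ := ih (chainsSubdiv F X (m + 1) z) (by
        rw [hsub, map_sub, map_sub, hd, sub_zero]
        exact Submodule.sub_mem _ hz (d_mem_smallChains F hT)) hl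
      refine ⟨y + chainsHomotopy F X (m + 1) z, ?_⟩
      have := Submodule.add_mem _ hy hT
      rw [hsub] at this
      rw [map_add]
      convert this using 1
      abel
  exact key k z hz (hk k le_rfl)

end SmallSimplices

/-! ### The Mayer–Vietoris sequence -/

section ExactSequence

open CategoryTheory.Limits HomologicalComplex

variable {F : Type u} [Field F] {K A B S : ChainComplex (ModuleCat.{u} F) ℕ}

/-- A monomorphism of chain complexes whose cokernel is acyclic induces isomorphisms in homology. -/
lemma isIso_homologyMap_of_mono {h : K ⟶ S} [Mono h] (hQ : ∀ n, (cokernel h).ExactAt n) (n : ℕ) :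
    IsIso (homologyMap h n) := by
  have hS : (ShortComplex.mk h (cokernel.π h) (cokernel.condition h)).ShortExact :=
    { exact := ShortComplex.exact_cokernel h }
  have h1 : Epi (homologyMap h n) := (hS.homology_exact₂ n).epi_f
    ((hQ n).isZero_homology.eq_of_tgt _ _)
  have h2 : Mono (homologyMap h n) := (hS.homology_exact₁ (n + 1) n rfl).mono_g
    ((hQ (n + 1)).isZero_homology.eq_of_src _ _)
  exact isIso_of_mono_of_epi _

/-- The cokernel of a monomorphism `h : K ⟶ S` is acyclic if every chain of `S` whose boundary
comes from `K` is homologous to a chain coming from `K`. -/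
lemma exactAt_cokernel {h : K ⟶ S} [Mono h]
    (h0 : ∀ z : S.X 0, z ∈ LinearMap.range (h.f 0).hom)
    (hs : ∀ (n : ℕ) (z : S.X (n + 1)), (S.d (n + 1) n).hom z ∈ LinearMap.range (h.f n).hom →
      ∃ y, z - (S.d (n + 2) (n + 1)).hom y ∈ LinearMap.range (h.f (n + 1)).hom) (n : ℕ) :
    (cokernel h).ExactAt n := by
  have hS : (ShortComplex.mk h (cokernel.π h) (cokernel.condition h)).ShortExact :=
    { exact := ShortComplex.exact_cokernel h }
  have hn (n : ℕ) := (shortExact_iff_degreewise_shortExact _).1 hS n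
  have hsurj (n : ℕ) : Function.Surjective ((cokernel.π h).f n).hom :=
    (hn n).moduleCat_surjective_g
  have hker (n : ℕ) (z : S.X n) (hz : ((cokernel.π h).f n).hom z = 0) :
      z ∈ LinearMap.range (h.f n).hom :=
    ((ShortComplex.moduleCat_exact_iff _).1 (hn n).exact z hz)
  have hzero (n : ℕ) (z : S.X n) (hz : z ∈ LinearMap.range (h.f n).hom) :
      ((cokernel.π h).f n).hom z = 0 := by
    obtain ⟨k, rfl⟩ := hz
    exact congrArg (fun g => (g.f n).hom k) (cokernel.condition h)
  have hd (m n : ℕ) (z : S.X m) : ((cokernel h).d m n).hom (((cokernel.π h).f m).hom z) =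
      ((cokernel.π h).f n).hom ((S.d m n).hom z) :=
    congrArg (fun g => g.hom z) ((cokernel.π h).comm m n)
  cases n with
  | zero =>
    rw [exactAt_iff' _ 1 0 0 (by simp) (by simp), ShortComplex.moduleCat_exact_iff]
    intro q _
    obtain ⟨z, rfl⟩ := hsurj 0 q
    exact ⟨0, (map_zero _).trans (hzero 0 z (h0 z)).symm⟩
  | succ n =>
    rw [exactAt_iff' _ (n + 2) (n + 1) n (by simp) (by simp), ShortComplex.moduleCat_exact_iff]
    intro q hq
    obtain ⟨z, rfl⟩ := hsurj (n + 1) q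
    obtain ⟨y, hy⟩ := hs n z (hker n _ ((hd _ _ z).symm.trans hq))
    refine ⟨((cokernel.π h).f (n + 2)).hom y, ?_⟩
    have := hzero _ _ hy
    rw [map_sub, sub_eq_zero] at this
    exact (hd _ _ y).trans this.symm

/-- The algebraic Mayer–Vietoris sequence. Here `K` is the pullback of `A` and `B` over `S`, and `S`
is acyclic modulo the sum of the images of `A` and `B`. Then `S` has the homology of the cokernel of
`K ⟶ A ⊞ B`, and the sequence is the one of `0 ⟶ K ⟶ A ⊞ B ⟶ cokernel ⟶ 0`. -/
theorem exists_mayerVietoris_sequence {α : K ⟶ A} {β : K ⟶ B} {φ : A ⟶ S} {ψ : B ⟶ S}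
    (hcomm : α ≫ φ = β ≫ ψ)
    (hα : ∀ n, Function.Injective (α.f n).hom)
    (hpull : ∀ (n : ℕ) (a : A.X n) (b : B.X n), (φ.f n).hom a = (ψ.f n).hom b →
      ∃ k, (α.f n).hom k = a ∧ (β.f n).hom k = b)
    (h0 : ∀ z : S.X 0, z ∈ LinearMap.range (φ.f 0).hom ⊔ LinearMap.range (ψ.f 0).hom)
    (hs : ∀ (n : ℕ) (z : S.X (n + 1)),
      (S.d (n + 1) n).hom z ∈ LinearMap.range (φ.f n).hom ⊔ LinearMap.range (ψ.f n).hom →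
      ∃ y, z - (S.d (n + 2) (n + 1)).hom y ∈
        LinearMap.range (φ.f (n + 1)).hom ⊔ LinearMap.range (ψ.f (n + 1)).hom) :
    (∀ (r : ℕ) (x : A.homology r) (y : B.homology r),
      (homologyMap φ r).hom x = (homologyMap ψ r).hom y →
      ∃ z, (homologyMap α r).hom z = x ∧ (homologyMap β r).hom z = y) ∧
    (∀ w : S.homology 0, ∃ x y, (homologyMap φ 0).hom x + (homologyMap ψ 0).hom y = w) ∧
    (∀ r : ℕ, ∃ δ : S.homology (r + 1) →ₗ[F] K.homology r,
      (∀ w, δ w = 0 ↔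
        ∃ x y, (homologyMap φ (r + 1)).hom x + (homologyMap ψ (r + 1)).hom y = w) ∧
      (∀ z, ((homologyMap α r).hom z = 0 ∧ (homologyMap β r).hom z = 0) ↔ ∃ w, δ w = z)) := by
  -- the sign is put on `ψ`, so that the composite `K ⟶ A ⊞ B ⟶ S` vanishes
  let f : K ⟶ A ⊞ B := biprod.lift α β
  let g : A ⊞ B ⟶ S := biprod.desc φ (-ψ)
  have hfg : f ≫ g = 0 := by simp [f, g, hcomm]
  have hg (n : ℕ) (p : (A ⊞ B : ChainComplex _ ℕ).X n) : (g.f n).hom p =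
      (φ.f n).hom (((biprod.fst : A ⊞ B ⟶ A).f n).hom p) -
        (ψ.f n).hom (((biprod.snd : A ⊞ B ⟶ B).f n).hom p) := by
    have : g = biprod.fst ≫ φ - biprod.snd ≫ ψ := by
      apply biprod.hom_ext' <;> simp [g]
    rw [this]
    rfl
  have hf1 : f ≫ biprod.fst = α := by simp [f]
  have hf2 : f ≫ biprod.snd = β := by simp [f]
  have hmono : Mono f := by
    have : Mono α := mono_of_mono_f _ fun n => (ModuleCat.mono_iff_injective _).2 (hα n)
    exact mono_of_mono_fac hf1
  have hex : (ShortComplex.mk f g hfg).Exact := by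
    refine exact_of_degreewise_exact _ fun n => ?_
    rw [ShortComplex.moduleCat_exact_iff]
    intro (p : (A ⊞ B : ChainComplex _ ℕ).X n) (hp : (g.f n).hom p = 0)
    obtain ⟨k, hk1, hk2⟩ := hpull n _ _ (sub_eq_zero.1 ((hg n p).symm.trans hp))
    refine ⟨k, ?_⟩
    have htot (p : (A ⊞ B : ChainComplex _ ℕ).X n) :
        p = ((biprod.inl : A ⟶ A ⊞ B).f n).hom (((biprod.fst : A ⊞ B ⟶ A).f n).hom p) +
          ((biprod.inr : B ⟶ A ⊞ B).f n).hom (((biprod.snd : A ⊞ B ⟶ B).f n).hom p) :=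
      congrArg (fun h : A ⊞ B ⟶ A ⊞ B => (h.f n).hom p) (biprod.total (X := A) (Y := B)).symm
    have e1 : ((biprod.fst : A ⊞ B ⟶ A).f n).hom ((f.f n).hom k) = (α.f n).hom k :=
      congrArg (fun h : K ⟶ A => (h.f n).hom k) hf1
    have e2 : ((biprod.snd : A ⊞ B ⟶ B).f n).hom ((f.f n).hom k) = (β.f n).hom k :=
      congrArg (fun h : K ⟶ B => (h.f n).hom k) hf2
    change (f.f n).hom k = p
    rw [htot p, htot ((f.f n).hom k), e1, e2, hk1, hk2]
  have hSE : (ShortComplex.mk f (cokernel.π f) (cokernel.condition f)).ShortExact :=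
    { exact := ShortComplex.exact_cokernel f }
  let h : cokernel f ⟶ S := cokernel.desc f g hfg
  have hπh : cokernel.π f ≫ h = g := cokernel.π_desc f g hfg
  have hmh : Mono h := (ShortComplex.exact_iff_mono_cokernel_desc _).1 hex
  have hrange (n : ℕ) : LinearMap.range (h.f n).hom =
      LinearMap.range (φ.f n).hom ⊔ LinearMap.range (ψ.f n).hom := by
    apply le_antisymm
    · rintro _ ⟨q, rfl⟩
      obtain ⟨p, rfl⟩ : ∃ p, ((cokernel.π f).f n).hom p = q :=
        ((shortExact_iff_degreewise_shortExact _).1 hSE n).moduleCat_surjective_g q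
      have : (h.f n).hom (((cokernel.π f).f n).hom p) = (g.f n).hom p :=
        congrArg (fun k : A ⊞ B ⟶ S => (k.f n).hom p) hπh
      rw [this, hg, sub_eq_add_neg, ← map_neg]
      exact Submodule.add_mem_sup ⟨_, rfl⟩ ⟨_, rfl⟩
    · refine sup_le ?_ ?_
      · rintro _ ⟨a, rfl⟩
        have : biprod.inl ≫ cokernel.π f ≫ h = φ := by simp [hπh, g]
        exact ⟨_, congrArg (fun k : A ⟶ S => (k.f n).hom a) this⟩
      · rintro _ ⟨b, rfl⟩
        have : (-biprod.inr) ≫ cokernel.π f ≫ h = ψ := by simp [hπh, g]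
        exact ⟨_, congrArg (fun k : B ⟶ S => (k.f n).hom b) this⟩
  have hiso (n : ℕ) : IsIso (homologyMap h n) :=
    isIso_homologyMap_of_mono (exactAt_cokernel (by rw [hrange]; exact h0)
      (fun n => by rw [hrange, hrange]; exact hs n)) n
  have hbij (n : ℕ) : Function.Bijective (homologyMap h n).hom :=
    (ConcreteCategory.isIso_iff_bijective (homologyMap h n)).1 (hiso n)
  have hHπh (n : ℕ) (q : (A ⊞ B).homology n) :
      (homologyMap h n).hom ((homologyMap (cokernel.π f) n).hom q) = (homologyMap g n).hom q := by
    rw [← hπh, homologyMap_comp]; rfl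
  have hHinl (n : ℕ) (x : A.homology n) :
      (homologyMap g n).hom ((homologyMap (biprod.inl : A ⟶ A ⊞ B) n).hom x) =
        (homologyMap φ n).hom x := by
    have : biprod.inl ≫ g = φ := by simp [g]
    rw [← this, homologyMap_comp]; rfl
  have hHinr (n : ℕ) (y : B.homology n) :
      (homologyMap g n).hom ((homologyMap (biprod.inr : B ⟶ A ⊞ B) n).hom y) =
        -(homologyMap ψ n).hom y := by
    have : biprod.inr ≫ g = -ψ := by simp [g]
    have h' := congrArg (fun k => k.hom y) (homologyMap_comp biprod.inr g n)
    rw [this, homologyMap_neg] at h'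
    exact h'.symm
  have hHf1 (n : ℕ) (z : K.homology n) :
      (homologyMap (biprod.fst : A ⊞ B ⟶ A) n).hom ((homologyMap f n).hom z) =
        (homologyMap α n).hom z := by
    rw [← hf1, homologyMap_comp]; rfl
  have hHf2 (n : ℕ) (z : K.homology n) :
      (homologyMap (biprod.snd : A ⊞ B ⟶ B) n).hom ((homologyMap f n).hom z) =
        (homologyMap β n).hom z := by
    rw [← hf2, homologyMap_comp]; rfl
  have hHtot (n : ℕ) (q : (A ⊞ B).homology n) :
      q = (homologyMap (biprod.inl : A ⟶ A ⊞ B) n).hom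
          ((homologyMap (biprod.fst : A ⊞ B ⟶ A) n).hom q) +
        (homologyMap (biprod.inr : B ⟶ A ⊞ B) n).hom
          ((homologyMap (biprod.snd : A ⊞ B ⟶ B) n).hom q) := by
    have h' := congrArg (fun k => ModuleCat.Hom.hom (homologyMap k n) q)
      (biprod.total (X := A) (Y := B))
    simp only [homologyMap_add, homologyMap_comp, homologyMap_id] at h'
    exact h'.symm
  -- the image of `H(g)` is the sum of the images of `H(φ)` and `H(ψ)`
  have hHg (n : ℕ) (w : S.homology n) : (∃ q, (homologyMap g n).hom q = w) ↔
      ∃ x y, (homologyMap φ n).hom x + (homologyMap ψ n).hom y = w := by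
    constructor
    · rintro ⟨q, rfl⟩
      refine ⟨(homologyMap (biprod.fst : A ⊞ B ⟶ A) n).hom q,
        -(homologyMap (biprod.snd : A ⊞ B ⟶ B) n).hom q, ?_⟩
      conv_rhs => rw [hHtot n q, map_add, hHinl, hHinr]
      rw [map_neg]
    · rintro ⟨x, y, rfl⟩
      refine ⟨(homologyMap (biprod.inl : A ⟶ A ⊞ B) n).hom x +
        (homologyMap (biprod.inr : B ⟶ A ⊞ B) n).hom (-y), ?_⟩
      rw [map_add, hHinl, hHinr, map_neg, neg_neg]
  refine ⟨fun r x y hxy => ?_, fun w => ?_, fun r => ?_⟩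
  · let q := (homologyMap (biprod.inl : A ⟶ A ⊞ B) r).hom x +
      (homologyMap (biprod.inr : B ⟶ A ⊞ B) r).hom y
    have hq : (homologyMap (cokernel.π f) r).hom q = 0 := by
      apply (hbij r).1
      rw [hHπh, map_zero, map_add, hHinl, hHinr, hxy, add_neg_cancel]
    obtain ⟨z, hz⟩ := (ShortComplex.moduleCat_exact_iff _).1 (hSE.homology_exact₂ r) q hq
    change (homologyMap f r).hom z = q at hz
    refine ⟨z, ?_, ?_⟩
    · rw [← hHf1, hz, map_add]
      simp only [← LinearMap.comp_apply, ← ModuleCat.hom_comp, ← homologyMap_comp]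
      simp
    · rw [← hHf2, hz, map_add]
      simp only [← LinearMap.comp_apply, ← ModuleCat.hom_comp, ← homologyMap_comp]
      simp
  · rw [← hHg]
    have := epi_homologyMap_of_epi_of_not_rel (cokernel.π f) 0 (by simp)
    obtain ⟨w', rfl⟩ := (hbij 0).2 w
    obtain ⟨q, rfl⟩ := (ModuleCat.epi_iff_surjective _).1 this w'
    exact ⟨q, (hHπh 0 q).symm⟩
  · let e := LinearEquiv.ofBijective (homologyMap h (r + 1)).hom (hbij (r + 1))
    refine ⟨(hSE.δ (r + 1) r rfl).hom ∘ₗ e.symm.toLinearMap, fun w => ?_, fun z => ?_⟩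
    · obtain ⟨w', rfl⟩ := e.surjective w
      rw [← hHg, LinearMap.comp_apply]
      change (hSE.δ (r + 1) r rfl).hom (e.symm (e w')) = 0 ↔ _
      rw [e.symm_apply_apply]
      constructor
      · intro hw
        obtain ⟨q, rfl⟩ := (ShortComplex.moduleCat_exact_iff _).1
          (hSE.homology_exact₃ (r + 1) r rfl) w' hw
        exact ⟨q, (hHπh _ q).symm⟩
      · rintro ⟨q, hq⟩
        have : w' = (homologyMap (cokernel.π f) (r + 1)).hom q :=
          (hbij (r + 1)).1 ((hHπh _ q).trans hq).symm
        rw [this]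
        exact congrArg (fun k => k.hom q) (hSE.comp_δ (r + 1) r rfl)
    · constructor
      · rintro ⟨hz1, hz2⟩
        obtain ⟨w', hw'⟩ := (ShortComplex.moduleCat_exact_iff _).1
          (hSE.homology_exact₁ (r + 1) r rfl) z (by
            change (homologyMap f r).hom z = 0
            rw [hHtot r ((homologyMap f r).hom z), hHf1, hHf2, hz1, hz2, map_zero, map_zero,
              add_zero])
        refine ⟨e w', ?_⟩
        change (hSE.δ (r + 1) r rfl).hom (e.symm (e w')) = z
        rw [e.symm_apply_apply]
        exact hw'
      · rintro ⟨w, rfl⟩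
        have : (homologyMap f r).hom ((hSE.δ (r + 1) r rfl).hom (e.symm w)) = 0 :=
          congrArg (fun k => k.hom (e.symm w)) (hSE.δ_comp (r + 1) r rfl)
        constructor
        · refine (hHf1 _ _).symm.trans ?_
          exact (congrArg _ this).trans (map_zero _)
        · refine (hHf2 _ _).symm.trans ?_
          exact (congrArg _ this).trans (map_zero _)

end ExactSequence

section MayerVietoris

variable (F : Type u) [Field F] {X : Type u} [TopologicalSpace X] {I A B C : Set X}

/-- The Mayer–Vietoris sequence of a square of inclusions `I ⊆ A`, `I ⊆ B`, `A ⊆ C`, `B ⊆ C`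
is exact. The connecting maps are only asserted to exist. In degree zero, the sequence ends with a
surjection onto `H_0(C)`. -/
structure IsMayerVietoris (hIA : I ⊆ A) (hIB : I ⊆ B) (hAC : A ⊆ C) (hBC : B ⊆ C) : Prop where
  exact_sum : ∀ (r : ℕ) (x : Homology F r A) (y : Homology F r B),
    homologyInclusion F r hAC x = homologyInclusion F r hBC y →
    ∃ z, homologyInclusion F r hIA z = x ∧ homologyInclusion F r hIB z = y
  surjective_zero : ∀ w : Homology F 0 C,
    ∃ x y, homologyInclusion F 0 hAC x + homologyInclusion F 0 hBC y = w
  exists_delta : ∀ r : ℕ, ∃ δ : Homology F (r + 1) C →ₗ[F] Homology F r I,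
    (∀ w, δ w = 0 ↔
      ∃ x y, homologyInclusion F (r + 1) hAC x + homologyInclusion F (r + 1) hBC y = w) ∧
    (∀ z, (homologyInclusion F r hIA z = 0 ∧ homologyInclusion F r hIB z = 0) ↔ ∃ w, δ w = z)

lemma isEmbedding_inclusionMap (h : A ⊆ B) : Topology.IsEmbedding (inclusionMap h) :=
  Topology.IsEmbedding.inclusion h

lemma range_inclusionMap (h : A ⊆ B) : range (inclusionMap h) = {x : B | x.1 ∈ A} :=
  range_inclusion h

/-- The chains coming from a subspace are the combinations of its singular simplices. -/
lemma mem_range_chainsMap_iff {A C : Type u} [TopologicalSpace A] [TopologicalSpace C] {n : ℕ}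
    {φ : C(A, C)} (hφ : Topology.IsEmbedding φ)
    {b : Module.Basis C(Simplex n, C) F ((chains F C).X n)}
    (hb : ∀ σ, b σ = singularSimplex F σ) (z : (chains F C).X n) :
    z ∈ LinearMap.range ((chainsMap F φ).f n).hom ↔
      ∀ σ ∈ (b.repr z).support, ∀ t, σ t ∈ range φ := by
  constructor
  · rintro ⟨a, rfl⟩
    obtain ⟨b', hb'⟩ := exists_basis F (A := A) n
    suffices h : b.repr (((chainsMap F φ).f n).hom a) ∈ Finsupp.supported F F
        {σ : C(Simplex n, C) | ∀ t, σ t ∈ range φ} from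
      fun σ hσ => (Finsupp.mem_supported _ _).1 h hσ
    rw [← b'.linearCombination_repr a, Finsupp.linearCombination_apply, Finsupp.sum, map_sum,
      map_sum]
    refine Submodule.sum_mem _ fun σ _ => ?_
    rw [map_smul, map_smul, hb', chainsMap_singularSimplex, ← hb, b.repr_self]
    exact Submodule.smul_mem _ _ (Finsupp.single_mem_supported F _ fun t => ⟨σ t, rfl⟩)
  · intro h
    rw [← b.linearCombination_repr z]
    refine Submodule.sum_mem _ fun σ hσ => Submodule.smul_mem _ _ ?_
    rw [hb]
    exact singularSimplex_mem_range F hφ (h σ hσ)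

lemma chainsMap_injective {A C : Type u} [TopologicalSpace A] [TopologicalSpace C]
    {φ : C(A, C)} (hφ : Function.Injective φ) (n : ℕ) :
    Function.Injective ((chainsMap F φ).f n).hom := by
  obtain ⟨b, hb⟩ := exists_basis F (A := A) n
  obtain ⟨b', hb'⟩ := exists_basis F (A := C) n
  have hli : LinearIndependent F (((chainsMap F φ).f n).hom ∘ b) := by
    have : ((chainsMap F φ).f n).hom ∘ b = b' ∘ (fun σ => φ.comp σ) := by
      funext σ
      simp only [Function.comp_apply, hb, hb', chainsMap_singularSimplex]
    rw [this]
    refine b'.linearIndependent.comp _ fun σ τ h => ?_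
    ext t
    exact hφ (DFunLike.congr_fun h t)
  have hx (x) : Finsupp.linearCombination F (((chainsMap F φ).f n).hom ∘ b) (b.repr x) =
      ((chainsMap F φ).f n).hom x := by
    rw [← LinearMap.map_finsupp_linearCombination, b.linearCombination_repr]
  intro x y h
  apply b.repr.injective
  apply hli
  rw [hx, hx, h]

/-- A square of subspaces is a Mayer–Vietoris square if the interiors of two of the subspaces,
which meet in the first one, cover the last one. -/
theorem isMayerVietoris_of_isOpen (hI : I = A ∩ B) {U V : Set X}
    (hU : IsOpen U) (hV : IsOpen V) (hUA : C ∩ U ⊆ A) (hVB : C ∩ V ⊆ B) (hUV : C ⊆ U ∪ V)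
    (hIA : I ⊆ A) (hIB : I ⊆ B) (hAC : A ⊆ C) (hBC : B ⊆ C) :
    IsMayerVietoris F hIA hIB hAC hBC := by
  have hcov :
      interior (range (inclusionMap hAC)) ∪ interior (range (inclusionMap hBC)) = univ := by
    rw [range_inclusionMap, range_inclusionMap]
    refine eq_univ_of_forall fun x => (hUV x.2).imp (fun hx => ?_) fun hx => ?_
    · exact mem_interior.2 ⟨Subtype.val ⁻¹' U, fun y hy => hUA ⟨y.2, hy⟩,
        hU.preimage continuous_subtype_val, hx⟩
    · exact mem_interior.2 ⟨Subtype.val ⁻¹' V, fun y hy => hVB ⟨y.2, hy⟩,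
        hV.preimage continuous_subtype_val, hx⟩
  have hcov' : range (inclusionMap hAC) ∪ range (inclusionMap hBC) = univ :=
    eq_univ_of_univ_subset (hcov ▸ union_subset_union interior_subset interior_subset)
  have key := exists_mayerVietoris_sequence (α := chainsMap F (inclusionMap hIA))
    (β := chainsMap F (inclusionMap hIB)) (φ := chainsMap F (inclusionMap hAC))
    (ψ := chainsMap F (inclusionMap hBC)) ?_ ?_ ?_
    (mem_smallChains_zero F (isEmbedding_inclusionMap hAC) (isEmbedding_inclusionMap hBC) hcov')
    (fun n => exists_sub_d_mem_smallChains F (isEmbedding_inclusionMap hAC)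
      (isEmbedding_inclusionMap hBC) hcov)
  · exact ⟨key.1, key.2.1, key.2.2⟩
  · rw [← Functor.map_comp, ← Functor.map_comp]
    rfl
  · exact fun n => chainsMap_injective F (isEmbedding_inclusionMap hIA).injective n
  · -- a chain of `C` that comes from `A` and from `B` involves only simplices in `I = A ∩ B`
    intro n a b hab
    obtain ⟨e, he⟩ := exists_basis F (A := C) n
    have hIC : I ⊆ C := hIA.trans hAC
    obtain ⟨k, hk⟩ := (mem_range_chainsMap_iff F (isEmbedding_inclusionMap hIC) he
      (((chainsMap F (inclusionMap hAC)).f n).hom a)).2 (fun σ hσ t => by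
        have h1 := (mem_range_chainsMap_iff F (isEmbedding_inclusionMap hAC) he _).1 ⟨a, rfl⟩
          σ hσ t
        have h2 := (mem_range_chainsMap_iff F (isEmbedding_inclusionMap hBC) he _).1 ⟨b, hab.symm⟩
          σ hσ t
        rw [range_inclusionMap] at h1 h2 ⊢
        exact hI ▸ ⟨h1, h2⟩)
    have hA : chainsMap F (inclusionMap hIA) ≫ chainsMap F (inclusionMap hAC) =
        chainsMap F (inclusionMap hIC) := (Functor.map_comp _ _ _).symm
    have hB : chainsMap F (inclusionMap hIB) ≫ chainsMap F (inclusionMap hBC) =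
        chainsMap F (inclusionMap hIC) := (Functor.map_comp _ _ _).symm
    refine ⟨k, ?_, ?_⟩
    · apply chainsMap_injective F (isEmbedding_inclusionMap hAC).injective n
      rw [← hk, ← hA]
      rfl
    · apply chainsMap_injective F (isEmbedding_inclusionMap hBC).injective n
      rw [← hab, ← hk, ← hB]
      rfl

end MayerVietoris

/-! ### Homology equivalences -/

section HomologyEquivalences

variable (F : Type u) [Field F] {X : Type u} [TopologicalSpace X] {I I' A A' B B' C : Set X}

lemma homologyInclusion_comp (r : ℕ) (hAB : A ⊆ B) (hBC : B ⊆ C) (x : Homology F r A) :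
    homologyInclusion F r hBC (homologyInclusion F r hAB x) =
      homologyInclusion F r (hAB.trans hBC) x := by
  have : TopCat.ofHom (inclusionMap hAB) ≫ TopCat.ofHom (inclusionMap hBC) =
    TopCat.ofHom (inclusionMap (hAB.trans hBC)) := rfl
  simp only [homologyInclusion]
  rw [← this, Functor.map_comp]
  rfl

lemma homologyInclusion_self (r : ℕ) (x : Homology F r A) :
    homologyInclusion F r (Subset.refl A) x = x := by
  have : TopCat.ofHom (inclusionMap (Subset.refl A)) = 𝟙 (TopCat.of A) := rfl
  simp only [homologyInclusion]
  rw [this, CategoryTheory.Functor.map_id]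
  rfl

/-- `A ⊆ B`, and the inclusion induces isomorphisms of all homology spaces. -/
def IsHomologyEquiv (A B : Set X) : Prop :=
  ∃ h : A ⊆ B, ∀ r, Function.Bijective (homologyInclusion F r h)

variable {F}

lemma IsHomologyEquiv.refl (A : Set X) : IsHomologyEquiv F A A :=
  ⟨Subset.refl A, fun r => by
    have : ⇑(homologyInclusion F r (Subset.refl A)) = id := funext (homologyInclusion_self F r)
    rw [this]
    exact Function.bijective_id⟩

lemma IsHomologyEquiv.trans (h : IsHomologyEquiv F A B) (h' : IsHomologyEquiv F B C) :
    IsHomologyEquiv F A C := by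
  obtain ⟨h, hb⟩ := h
  obtain ⟨h', hb'⟩ := h'
  refine ⟨h.trans h', fun r => ?_⟩
  have : ⇑(homologyInclusion F r (h.trans h')) =
      homologyInclusion F r h' ∘ homologyInclusion F r h :=
    funext fun x => (homologyInclusion_comp F r h h' x).symm
  rw [this]
  exact (hb' r).comp (hb r)

/-- Homotopy invariance of homology: an inclusion with homotopy inverse `ρ` is a homology
equivalence. -/
lemma isHomologyEquiv_of_homotopic (h : A ⊆ B) (ρ : C(B, A))
    (h1 : (ρ.comp (inclusionMap h)).Homotopic (ContinuousMap.id A))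
    (h2 : ((inclusionMap h).comp ρ).Homotopic (ContinuousMap.id B)) : IsHomologyEquiv F A B := by
  refine ⟨h, fun r => ?_⟩
  obtain ⟨H1⟩ := h1
  obtain ⟨H2⟩ := h2
  let G := (AlgebraicTopology.singularHomologyFunctor (ModuleCat.{u} F) r).obj (ModuleCat.of F F)
  have e1 : G.map (TopCat.ofHom (inclusionMap h)) ≫ G.map (TopCat.ofHom ρ) = 𝟙 _ := by
    rw [← G.map_comp, ← G.map_id]
    exact TopCat.Homotopy.congr_homologyMap_singularChainComplexFunctor
      (f := TopCat.ofHom (inclusionMap h) ≫ TopCat.ofHom ρ) (g := 𝟙 _) H1 _ r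
  have e2 : G.map (TopCat.ofHom ρ) ≫ G.map (TopCat.ofHom (inclusionMap h)) = 𝟙 _ := by
    rw [← G.map_comp, ← G.map_id]
    exact TopCat.Homotopy.congr_homologyMap_singularChainComplexFunctor
      (f := TopCat.ofHom ρ ≫ TopCat.ofHom (inclusionMap h)) (g := 𝟙 _) H2 _ r
  refine Function.bijective_iff_has_inverse.2
    ⟨(G.map (TopCat.ofHom ρ)).hom, fun x => ?_, fun x => ?_⟩
  · exact congrArg (fun k => k.hom x) e1
  · exact congrArg (fun k => k.hom x) e2

lemma InclusionIsHomotopyEquiv.isHomologyEquiv (h : InclusionIsHomotopyEquiv A B) :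
    IsHomologyEquiv F A B := by
  obtain ⟨h, e, he⟩ := h
  exact isHomologyEquiv_of_homotopic h e.invFun (he ▸ e.left_inv) (he ▸ e.right_inv)

section

variable {hIA : I ⊆ A} {hIB : I ⊆ B} {hAC : A ⊆ C} {hBC : B ⊆ C}

lemma IsMayerVietoris.symm (h : IsMayerVietoris F hIA hIB hAC hBC) :
    IsMayerVietoris F hIB hIA hBC hAC where
  exact_sum r x y hxy := by
    obtain ⟨z, h1, h2⟩ := h.exact_sum r y x hxy.symm
    exact ⟨z, h2, h1⟩
  surjective_zero w := by
    obtain ⟨x, y, h⟩ := h.surjective_zero w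
    exact ⟨y, x, (add_comm _ _).trans h⟩
  exists_delta r := by
    obtain ⟨δ, h1, h2⟩ := h.exists_delta r
    refine ⟨δ, fun w => (h1 w).trans ⟨?_, ?_⟩, fun z => and_comm.trans (h2 z)⟩
    · rintro ⟨x, y, h⟩
      exact ⟨y, x, (add_comm _ _).trans h⟩
    · rintro ⟨x, y, h⟩
      exact ⟨y, x, (add_comm _ _).trans h⟩

lemma homologyInclusion_square (r : ℕ) (z : Homology F r I) :
    homologyInclusion F r hAC (homologyInclusion F r hIA z) =
      homologyInclusion F r hBC (homologyInclusion F r hIB z) := by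
  rw [homologyInclusion_comp, homologyInclusion_comp]

/-- A square with two opposite sides homology equivalences is a Mayer–Vietoris square, with
vanishing connecting maps. -/
lemma isMayerVietoris_of_isHomologyEquiv (h1 : IsHomologyEquiv F I B)
    (h2 : IsHomologyEquiv F A C) : IsMayerVietoris F hIA hIB hAC hBC where
  exact_sum r x y hxy := by
    obtain ⟨z, rfl⟩ := (h1.2 r).2 y
    exact ⟨z, (h2.2 r).1 ((homologyInclusion_square r z).trans hxy.symm), rfl⟩
  surjective_zero w := by
    obtain ⟨x, rfl⟩ := (h2.2 0).2 w
    exact ⟨x, 0, by rw [map_zero, add_zero]⟩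
  exists_delta r := by
    refine ⟨0, fun w => ⟨fun _ => ?_, fun _ => rfl⟩, fun z => ⟨fun hz => ⟨0, ?_⟩, ?_⟩⟩
    · obtain ⟨x, rfl⟩ := (h2.2 (r + 1)).2 w
      exact ⟨x, 0, by rw [map_zero, add_zero]⟩
    · exact ((h1.2 r).1 (hz.2.trans (map_zero _).symm)).symm
    · rintro ⟨w, rfl⟩
      simp

/-- Excision: if `H(I) → H(B)` is an isomorphism, so is `H(A) → H(C)`. -/
lemma IsMayerVietoris.isHomologyEquiv (h : IsMayerVietoris F hIA hIB hAC hBC)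
    (hI : IsHomologyEquiv F I B) : IsHomologyEquiv F A C := by
  refine ⟨hAC, fun r => ⟨?_, ?_⟩⟩
  · rw [injective_iff_map_eq_zero]
    intro x hx
    obtain ⟨z, rfl, hz⟩ := h.exact_sum r x 0 (hx.trans (map_zero _).symm)
    rw [(hI.2 r).1 (hz.trans (map_zero _).symm), map_zero]
  · have key (x : Homology F r A) (y : Homology F r B) :
        ∃ x', homologyInclusion F r hAC x' =
          homologyInclusion F r hAC x + homologyInclusion F r hBC y := by
      obtain ⟨z, rfl⟩ := (hI.2 r).2 y
      exact ⟨x + homologyInclusion F r hIA z, by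
        rw [map_add, homologyInclusion_square (hBC := hBC)]⟩
    intro w
    cases r with
    | zero =>
      obtain ⟨x, y, rfl⟩ := h.surjective_zero w
      exact key x y
    | succ r =>
      obtain ⟨δ, h1, h2⟩ := h.exists_delta r
      have h3 := (h2 (δ w)).2 ⟨w, rfl⟩
      have h4 : δ w = 0 := (hI.2 r).1 (h3.2.trans (map_zero _).symm)
      obtain ⟨x, y, rfl⟩ := (h1 w).1 h4
      exact key x y

/-- The Mayer–Vietoris sequence is unchanged when the subspaces are replaced by homologically
equivalent ones. -/
lemma IsMayerVietoris.of_isHomologyEquiv {hIA' : I' ⊆ A'} {hIB' : I' ⊆ B'} {hAC' : A' ⊆ C}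
    {hBC' : B' ⊆ C} (h : IsMayerVietoris F hIA' hIB' hAC' hBC') (hI : IsHomologyEquiv F I I')
    (hA : IsHomologyEquiv F A A') (hB : IsHomologyEquiv F B B') :
    IsMayerVietoris F hIA hIB hAC hBC := by
  have hsum (r : ℕ) (w : Homology F r C) :
      (∃ x y, homologyInclusion F r hAC x + homologyInclusion F r hBC y = w) ↔
        ∃ x y, homologyInclusion F r hAC' x + homologyInclusion F r hBC' y = w := by
    constructor
    · rintro ⟨x, y, rfl⟩
      exact ⟨homologyInclusion F r hA.1 x, homologyInclusion F r hB.1 y, by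
        rw [homologyInclusion_comp, homologyInclusion_comp]⟩
    · rintro ⟨x, y, rfl⟩
      obtain ⟨x, rfl⟩ := (hA.2 r).2 x
      obtain ⟨y, rfl⟩ := (hB.2 r).2 y
      exact ⟨x, y, by rw [homologyInclusion_comp, homologyInclusion_comp]⟩
  have hzA (r : ℕ) (z : Homology F r I) :
      homologyInclusion F r hA.1 (homologyInclusion F r hIA z) =
        homologyInclusion F r hIA' (homologyInclusion F r hI.1 z) := homologyInclusion_square r z
  have hzB (r : ℕ) (z : Homology F r I) :
      homologyInclusion F r hB.1 (homologyInclusion F r hIB z) =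
        homologyInclusion F r hIB' (homologyInclusion F r hI.1 z) := homologyInclusion_square r z
  refine ⟨fun r x y hxy => ?_, fun w => (hsum 0 w).2 (h.surjective_zero w), fun r => ?_⟩
  · obtain ⟨z, h1, h2⟩ := h.exact_sum r (homologyInclusion F r hA.1 x)
      (homologyInclusion F r hB.1 y) (by
        rw [homologyInclusion_comp, homologyInclusion_comp, hxy])
    obtain ⟨z, rfl⟩ := (hI.2 r).2 z
    exact ⟨z, (hA.2 r).1 ((hzA r z).trans h1), (hB.2 r).1 ((hzB r z).trans h2)⟩
  · obtain ⟨δ, h1, h2⟩ := h.exists_delta r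
    let e := LinearEquiv.ofBijective (homologyInclusion F r hI.1) (hI.2 r)
    refine ⟨e.symm.toLinearMap ∘ₗ δ, fun w => ?_, fun z => ?_⟩
    · rw [hsum, ← h1, LinearMap.comp_apply]
      exact e.symm.map_eq_zero_iff
    · have h3 := h2 (e z)
      have hA0 : homologyInclusion F r hIA' (e z) = 0 ↔ homologyInclusion F r hIA z = 0 := by
        rw [← (injective_iff_map_eq_zero' _).1 (hA.2 r).1, hzA]; rfl
      have hB0 : homologyInclusion F r hIB' (e z) = 0 ↔ homologyInclusion F r hIB z = 0 := by
        rw [← (injective_iff_map_eq_zero' _).1 (hB.2 r).1, hzB]; rfl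
      rw [hA0, hB0] at h3
      rw [h3]
      refine exists_congr fun w => ?_
      exact (LinearEquiv.symm_apply_eq e).symm

end

end HomologyEquivalences

/-! ### Homology of interlevels of tame functions -/

section Interlevels

section

variable {X : Type u}

lemma interlevel_mono (f : X → ℝ) {a b a' b' : ℝ} (ha : a' ≤ a) (hb : b ≤ b') :
    interlevel f a b ⊆ interlevel f a' b' :=
  preimage_mono (Icc_subset_Icc ha hb)

lemma level_subset_interlevel (f : X → ℝ) {t a b : ℝ} (ha : a ≤ t) (hb : t ≤ b) :
    level f t ⊆ interlevel f a b :=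
  preimage_mono (singleton_subset_iff.2 ⟨ha, hb⟩)

lemma interlevel_self (f : X → ℝ) (t : ℝ) : interlevel f t t = level f t := by
  rw [interlevel, Icc_self, level]

lemma interlevel_neg (f : X → ℝ) (a b : ℝ) :
    interlevel (fun x => -f x) (-b) (-a) = interlevel f a b := by
  ext x
  simp [interlevel, and_comm]

lemma level_neg (f : X → ℝ) (t : ℝ) : level (fun x => -f x) (-t) = level f t := by
  ext x
  simp [level]

end

variable (F : Type u) [Field F] {X : Type u} [TopologicalSpace X] {f : X → ℝ} {T : Set ℝ}

/-- The homological content of tameness: the clauses of `IsTameWith`, with homology equivalences in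
place of homotopy equivalences. Unlike those clauses it passes from `f` to `-f` by an equality of
subspaces. -/
structure IsHomologicallyTame (f : X → ℝ) (T : Set ℝ) : Prop where
  continuous : Continuous f
  regular : ∀ t ∉ T, ∃ ε > 0, ∀ u v, t - ε ≤ u → u ≤ v → v ≤ t + ε →
    IsHomologyEquiv F (level f u) (interlevel f u v) ∧
    IsHomologyEquiv F (level f v) (interlevel f u v)
  level_inclusion : ∀ t, ∀ η > 0, ∃ ε, 0 < ε ∧ ε < η ∧
    IsHomologyEquiv F (level f t) (interlevel f (t - ε) (t + ε)) ∧
    IsHomologyEquiv F (level f t) (interlevel f (t - ε) t) ∧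
    IsHomologyEquiv F (level f t) (interlevel f t (t + ε))

/-- Over an interval on which `f` is fiberwise homotopy equivalent to a projection, each level
includes in each larger interlevel by a homology equivalence. -/
lemma isHomologyEquiv_of_fiberwise (hf : Continuous f) {t a b : ℝ}
    (h : FiberwiseHomotopyEquivalent (fun x : interlevel f a b => f x)
      (fun y : level f t × Icc a b => (y.2 : ℝ)))
    {u v w : ℝ} (ha : a ≤ u) (hb : v ≤ b) (hu : u ≤ w) (hv : w ≤ v) :
    IsHomologyEquiv F (level f w) (interlevel f u v) := by
  obtain ⟨φ, ψ, hφ, hψ, ⟨H, hH⟩, -⟩ := h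
  have hw : w ∈ Icc a b := ⟨ha.trans hu, hv.trans hb⟩
  have hsub := level_subset_interlevel f hu hv
  obtain ⟨ι, hι⟩ : ∃ ι : C(interlevel f u v, interlevel f a b), ∀ x, (ι x : X) = x :=
    ⟨inclusionMap (interlevel_mono f ha hb), fun _ => rfl⟩
  obtain ⟨i, hi⟩ : ∃ i : C(level f w, interlevel f u v), inclusionMap hsub = i := ⟨_, rfl⟩
  have hix (x : level f w) : (i x : X) = x := by rw [← hi]; rfl
  -- apply `φ`, move to the fibre over `w`, and go back by `ψ`
  let ρ : C(interlevel f u v, level f w) :=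
    ⟨fun x => ⟨ψ ((φ (ι x)).1, ⟨w, hw⟩), hψ _⟩, by fun_prop⟩
  have hconv (s : unitInterval) (x : interlevel f u v) : (1 - s : ℝ) * w + s * f x ∈ Icc u v :=
    (convex_Icc u v) ⟨hu, hv⟩ x.2 (by have := s.2.2; linarith) s.2.1 (by ring)
  obtain ⟨c, hc⟩ : ∃ c : C(unitInterval × interlevel f u v, Icc a b),
      ∀ p, (c p : ℝ) = (1 - p.1 : ℝ) * w + p.1 * f p.2 :=
    ⟨⟨fun p => ⟨(1 - p.1 : ℝ) * w + p.1 * f p.2,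
        ha.trans (hconv p.1 p.2).1, (hconv p.1 p.2).2.trans hb⟩, by fun_prop⟩, fun _ => rfl⟩
  have hφ2 (x : interlevel f u v) (y : Icc a b) (hy : (y : ℝ) = f x) :
      ((φ (ι x)).1, y) = φ (ι x) :=
    Prod.ext rfl (Subtype.ext (hy.trans ((hφ (ι x)).trans (congrArg f (hι x))).symm))
  have hH' (s : unitInterval) (x : interlevel f u v) : f (H (s, ι x)) = f x :=
    (hH s (ι x)).trans (congrArg f (hι x))
  have m1 (p : unitInterval × level f w) : (H (p.1, ι (i p.2)) : X) ∈ level f w := by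
    refine (hH' _ _).trans ?_
    rw [hix]
    exact p.2.2
  have m2 (p : unitInterval × interlevel f u v) : (H (p.1, ι p.2) : X) ∈ interlevel f u v := by
    change f (H (p.1, ι p.2)) ∈ Icc u v
    rw [hH']
    exact p.2.2
  have m3 (p : unitInterval × interlevel f u v) :
      (ψ ((φ (ι p.2)).1, c p) : X) ∈ interlevel f u v := by
    change f (ψ ((φ (ι p.2)).1, c p)) ∈ Icc u v
    exact (congrArg (· ∈ Icc u v) ((hψ _).trans (hc p))).mpr (hconv p.1 p.2)
  refine isHomologyEquiv_of_homotopic hsub ρ ⟨?_⟩ ?_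
  · rw [hi]
    refine ⟨⟨fun p => ⟨H (p.1, ι (i p.2)), m1 p⟩, by fun_prop⟩, fun x => ?_, fun x => ?_⟩
    · apply Subtype.ext
      change (H (0, ι (i x)) : X) = ψ ((φ (ι (i x))).1, ⟨w, hw⟩)
      rw [H.apply_zero, hφ2]
      · rfl
      · rw [hix]; exact x.2.symm
    · apply Subtype.ext
      change (H (1, ι (i x)) : X) = x
      rw [H.apply_one]
      exact (hι _).trans (hix x)
  · rw [hi]
    -- both maps are homotopic to the restriction of `ψ ∘ φ`
    let μ : C(interlevel f u v, interlevel f u v) :=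
      ⟨fun x => ⟨H (0, ι x), m2 (0, x)⟩, by fun_prop⟩
    have G1 : (i.comp ρ).Homotopic μ := by
      refine ⟨⟨⟨fun p => ⟨ψ ((φ (ι p.2)).1, c p), m3 p⟩, by fun_prop⟩, fun x => ?_, fun x => ?_⟩⟩
      · apply Subtype.ext
        refine Eq.trans ?_ (hix _).symm
        change (ψ ((φ (ι x)).1, c (0, x)) : X) = ψ ((φ (ι x)).1, ⟨w, hw⟩)
        congr 3
        apply Subtype.ext
        simp [hc]
      · apply Subtype.ext
        change (ψ ((φ (ι x)).1, c (1, x)) : X) = H (0, ι x)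
        rw [H.apply_zero, hφ2]
        · rfl
        · simp [hc]
    refine G1.trans ⟨⟨⟨fun p => ⟨H (p.1, ι p.2), m2 p⟩, by fun_prop⟩, fun x => rfl, fun x => ?_⟩⟩
    apply Subtype.ext
    change (H (1, ι x) : X) = x
    rw [H.apply_one]
    exact hι x

lemma IsTameWith.isHomologicallyTame (hf : IsTameWith f T) : IsHomologicallyTame F f T where
  continuous := hf.continuous
  regular t ht := by
    obtain ⟨ε, hε, h⟩ := hf.regular t ht
    exact ⟨ε, hε, fun u v hu huv hv =>
      ⟨isHomologyEquiv_of_fiberwise F hf.continuous h hu hv le_rfl huv,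
        isHomologyEquiv_of_fiberwise F hf.continuous h hu hv huv le_rfl⟩⟩
  level_inclusion t η hη := by
    obtain ⟨ε, h0, h1, h2, h3, h4⟩ := hf.level_inclusion t η hη
    exact ⟨ε, h0, h1, h2.isHomologyEquiv, h3.isHomologyEquiv, h4.isHomologyEquiv⟩

variable {F}

lemma IsHomologicallyTame.neg (hf : IsHomologicallyTame F f T) :
    IsHomologicallyTame F (fun x => -f x) (Neg.neg ⁻¹' T) where
  continuous := hf.continuous.neg
  regular t ht := by
    obtain ⟨ε, hε, h⟩ := hf.regular (-t) ht
    refine ⟨ε, hε, fun u v hu huv hv => ?_⟩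
    have := h (-v) (-u) (by linarith) (by linarith) (by linarith)
    rw [← interlevel_neg, ← level_neg, ← level_neg f (-u)] at this
    simp only [neg_neg] at this
    exact this.symm
  level_inclusion t η hη := by
    obtain ⟨ε, h0, h1, h2, h3, h4⟩ := hf.level_inclusion (-t) η hη
    refine ⟨ε, h0, h1, ?_⟩
    rw [← interlevel_neg, ← level_neg] at h2 h3 h4
    have e1 : -(-t - ε) = t + ε := by ring
    have e2 : -(-t + ε) = t - ε := by ring
    rw [e1, neg_neg] at h3
    rw [e2, neg_neg] at h4
    rw [e1, e2, neg_neg] at h2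
    exact ⟨h2, h4, h3⟩

lemma isMayerVietoris_interlevel_of_lt (hf : Continuous f) {a b c d : ℝ} (hab : a ≤ b)
    (hbc : b < c) (hcd : c ≤ d) :
    IsMayerVietoris F (interlevel_mono f hab le_rfl) (interlevel_mono f le_rfl hcd)
      (interlevel_mono f le_rfl hcd) (interlevel_mono f hab le_rfl) := by
  refine isMayerVietoris_of_isOpen F (U := f ⁻¹' Iio c) (V := f ⁻¹' Ioi b) ?_
    (isOpen_Iio.preimage hf) (isOpen_Ioi.preimage hf) ?_ ?_ ?_ _ _ _ _
  · ext x
    simp only [interlevel, mem_inter_iff, mem_preimage, mem_Icc]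
    constructor
    · rintro ⟨h1, h2⟩
      exact ⟨⟨hab.trans h1, h2⟩, h1, h2.trans hcd⟩
    · rintro ⟨⟨-, h2⟩, h1, -⟩
      exact ⟨h1, h2⟩
  · rintro x ⟨h1, h2⟩
    exact ⟨h1.1, le_of_lt h2⟩
  · rintro x ⟨h1, h2⟩
    exact ⟨le_of_lt h2, h1.2⟩
  · intro x _
    rcases lt_or_ge (f x) c with h | h
    · exact Or.inl h
    · exact Or.inr (hbc.trans_le h)

/-- The Mayer–Vietoris sequence of two adjacent interlevels, which meet in a level. Such a level
may be thickened by tameness. -/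
theorem IsHomologicallyTame.isMayerVietoris (hf : IsHomologicallyTame F f T) {a b d : ℝ}
    (hab : a ≤ b) (hbd : b ≤ d) :
    IsMayerVietoris F (level_subset_interlevel f hab le_rfl) (level_subset_interlevel f le_rfl hbd)
      (interlevel_mono f le_rfl hbd) (interlevel_mono f hab le_rfl) := by
  -- if one of the interlevels is the level itself, there is no room for a thickening
  rcases hab.eq_or_lt with rfl | hab'
  · refine (isMayerVietoris_of_isHomologyEquiv ?_ ?_).symm
    · rw [interlevel_self]; exact .refl _
    · exact .refl _
  rcases hbd.eq_or_lt with rfl | hbd'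
  · refine isMayerVietoris_of_isHomologyEquiv ?_ ?_
    · rw [interlevel_self]; exact .refl _
    · exact .refl _
  obtain ⟨ε, h0, h1, h2, h3, h4⟩ := hf.level_inclusion b (min (b - a) (d - b))
    (lt_min (by linarith) (by linarith))
  have ha : a ≤ b - ε := by linarith [h1.le.trans (min_le_left _ _)]
  have hd : b + ε ≤ d := by linarith [h1.le.trans (min_le_right _ _)]
  have cancel {A B C : Set X} (hAC : IsHomologyEquiv F A C) (hAB : IsHomologyEquiv F A B)
      (hBC : B ⊆ C) : IsHomologyEquiv F B C := by
    refine ⟨hBC, fun r => ?_⟩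
    rw [← Function.Bijective.of_comp_iff _ (hAB.2 r)]
    convert hAC.2 r using 1
    exact funext fun x => homologyInclusion_comp F r hAB.1 hBC x
  -- compare with the overlapping interlevels `X_{a,b+ε}` and `X_{b-ε,d}`
  refine (isMayerVietoris_interlevel_of_lt hf.continuous ha
    (show b - ε < b + ε by linarith) hd).of_isHomologyEquiv h2 ?_ ?_
  · exact (isMayerVietoris_interlevel_of_lt hf.continuous ha (show b - ε < b by linarith)
      (show b ≤ b + ε by linarith)).isHomologyEquiv
      (cancel h2 h3 (interlevel_mono f le_rfl (by linarith)))
  · exact (isMayerVietoris_interlevel_of_lt hf.continuous (show b - ε ≤ b by linarith)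
      (show b < b + ε by linarith) hd).symm.isHomologyEquiv
      (cancel h2 h4 (interlevel_mono f (by linarith) le_rfl))

/-- If there are no critical values in `(t, b]`, then `X_t` includes in `X_{t,b}` by a homology
equivalence: the supremum of the `u` for which this holds for `X_{t,u}` belongs to them by
regularity, and equals `b` since tameness allows to move on from it. -/
theorem IsHomologicallyTame.isHomologyEquiv_right (hf : IsHomologicallyTame F f T) {t b : ℝ}
    (htb : t ≤ b) (hT : ∀ u ∈ Ioc t b, u ∉ T) :
    IsHomologyEquiv F (level f t) (interlevel f t b) := by
  let S : Set ℝ := {u | u ∈ Icc t b ∧ IsHomologyEquiv F (level f t) (interlevel f t u)}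
  have htS : t ∈ S := ⟨⟨le_rfl, htb⟩, by rw [interlevel_self]; exact .refl _⟩
  have hbdd : BddAbove S := ⟨b, fun u hu => hu.1.2⟩
  have hext {u v : ℝ} (hu : u ∈ S) (huv : u ≤ v) (hv : v ≤ b)
      (h : IsHomologyEquiv F (level f u) (interlevel f u v)) : v ∈ S :=
    ⟨⟨hu.1.1.trans huv, hv⟩, hu.2.trans ((hf.isMayerVietoris hu.1.1 huv).isHomologyEquiv h)⟩
  have hcb : sSup S ≤ b := csSup_le ⟨t, htS⟩ fun u hu => hu.1.2
  have hcS : sSup S ∈ S := by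
    rcases (le_csSup hbdd htS).eq_or_lt with h | h
    · exact h ▸ htS
    · obtain ⟨ε, hε, hreg⟩ := hf.regular _ (hT _ ⟨h, hcb⟩)
      obtain ⟨u, hu, hlt⟩ := exists_lt_of_lt_csSup ⟨t, htS⟩
        (show sSup S - ε < sSup S by linarith)
      exact hext hu (le_csSup hbdd hu) hcb
        (hreg u _ hlt.le (le_csSup hbdd hu) (by linarith)).1
  rcases hcb.eq_or_lt with h | h
  · exact h ▸ hcS.2
  · obtain ⟨ε, h0, h1, -, -, h4⟩ := hf.level_inclusion (sSup S) (b - sSup S) (by linarith)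
    have := le_csSup hbdd (hext hcS (by linarith) (by linarith) h4)
    linarith

/-- If there are no critical values in `[a, t)`, then `X_t` includes in `X_{a,t}` by a homology
equivalence. -/
theorem IsHomologicallyTame.isHomologyEquiv_left (hf : IsHomologicallyTame F f T) {a t : ℝ}
    (hat : a ≤ t) (hT : ∀ u ∈ Ico a t, u ∉ T) :
    IsHomologyEquiv F (level f t) (interlevel f a t) := by
  rw [← level_neg, ← interlevel_neg]
  exact hf.neg.isHomologyEquiv_right (neg_le_neg hat) fun u hu =>
    hT (-u) ⟨by linarith [hu.2], by linarith [hu.1]⟩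

/-- The extreme values of a tame function on a compact space are critical, because close to a
regular value a fiberwise homotopy equivalence to a projection provides both larger and smaller values. -/
lemma IsTameWith.exists_mem_bounds [CompactSpace X] (hf : IsTameWith f T) (x : X) :
    (∃ t ∈ T, t ≤ f x) ∧ ∃ t ∈ T, f x ≤ t := by
  have key (m : X) (ht : f m ∉ T) :
      ∃ ε > 0, (∃ y, f y = f m - ε) ∧ ∃ y, f y = f m + ε := by
    obtain ⟨ε, hε, φ, ψ, hφ, hψ, -⟩ := hf.regular _ ht
    refine ⟨ε, hε, ⟨ψ (⟨m, rfl⟩, ⟨f m - ε, by constructor <;> linarith⟩), hψ _⟩,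
      ⟨ψ (⟨m, rfl⟩, ⟨f m + ε, by constructor <;> linarith⟩), hψ _⟩⟩
  obtain ⟨m, -, hm⟩ := isCompact_univ.exists_isMinOn ⟨x, mem_univ x⟩ hf.continuous.continuousOn
  obtain ⟨M, -, hM⟩ := isCompact_univ.exists_isMaxOn ⟨x, mem_univ x⟩ hf.continuous.continuousOn
  constructor
  · refine ⟨f m, by_contra fun h => ?_, hm (mem_univ x)⟩
    obtain ⟨ε, hε, ⟨y, hy⟩, -⟩ := key m h
    have := isMinOn_iff.1 hm y (mem_univ y)
    linarith
  · refine ⟨f M, by_contra fun h => ?_, hM (mem_univ x)⟩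
    obtain ⟨ε, hε, -, ⟨y, hy⟩⟩ := key M h
    have := isMaxOn_iff.1 hM y (mem_univ y)
    linarith

end Interlevels

/-! ### Dimensions in the Mayer–Vietoris sequence -/

section Dimensions

variable {F : Type u} [Field F] {X : Type u} [TopologicalSpace X] {I A B C : Set X}
  {hIA : I ⊆ A} {hIB : I ⊆ B} {hAC : A ⊆ C} {hBC : B ⊆ C}

variable (F) in
/-- The dimension of the kernel of `H_r(I) → H_r(A) ⊕ H_r(B)`. -/
def kernelDim (r : ℕ) (hIA : I ⊆ A) (hIB : I ⊆ B) : ℕ :=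
  Module.finrank F (LinearMap.ker (homologyInclusion F r hIA) ⊓
    LinearMap.ker (homologyInclusion F r hIB) : Submodule F (Homology F r I))

/-- The dimension of the sum of the images of `H_r(A)` and `H_r(B)` in `H_r(C)`: the kernel of
`H_r(A) ⊕ H_r(B) → H_r(C)` is the image of `H_r(I)`. -/
lemma IsMayerVietoris.finrank_range_add (h : IsMayerVietoris F hIA hIB hAC hBC) (r : ℕ)
    [Module.Finite F (Homology F r I)] [Module.Finite F (Homology F r A)]
    [Module.Finite F (Homology F r B)] :
    Module.finrank F (LinearMap.range ((homologyInclusion F r hAC).coprod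
        (homologyInclusion F r hBC))) + Module.finrank F (Homology F r I) =
      Module.finrank F (Homology F r A) + Module.finrank F (Homology F r B) +
        kernelDim F r hIA hIB := by
  let p := (homologyInclusion F r hAC).coprod (homologyInclusion F r hBC)
  let q := (homologyInclusion F r hIA).prod (-homologyInclusion F r hIB)
  have hpq : LinearMap.ker p = LinearMap.range q := by
    ext ⟨x, y⟩
    constructor
    · intro hxy
      have hxy' : homologyInclusion F r hAC x + homologyInclusion F r hBC y = 0 := hxy
      obtain ⟨z, rfl, hz⟩ := h.exact_sum r x (-y) (by
        rw [map_neg]; exact eq_neg_of_add_eq_zero_left hxy')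
      exact ⟨z, Prod.ext rfl ((congrArg Neg.neg hz).trans (neg_neg y))⟩
    · rintro ⟨z, hz⟩
      obtain ⟨rfl, rfl⟩ := Prod.ext_iff.1 hz
      change homologyInclusion F r hAC (homologyInclusion F r hIA z) +
        homologyInclusion F r hBC (-homologyInclusion F r hIB z) = 0
      rw [map_neg, homologyInclusion_square (hIB := hIB) (hBC := hBC), add_neg_cancel]
  have hker : LinearMap.ker q = LinearMap.ker (homologyInclusion F r hIA) ⊓
      LinearMap.ker (homologyInclusion F r hIB) := by
    rw [LinearMap.ker_prod, LinearMap.ker_neg]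
  have h1 := p.finrank_range_add_finrank_ker
  have h2 := q.finrank_range_add_finrank_ker
  rw [Module.finrank_prod] at h1
  rw [hpq] at h1
  rw [hker] at h2
  change Module.finrank F (LinearMap.range p) + _ = _
  rw [kernelDim]
  omega

lemma IsMayerVietoris.finite_zero (h : IsMayerVietoris F hIA hIB hAC hBC)
    [Module.Finite F (Homology F 0 A)] [Module.Finite F (Homology F 0 B)] :
    Module.Finite F (Homology F 0 C) :=
  Module.Finite.of_surjective ((homologyInclusion F 0 hAC).coprod (homologyInclusion F 0 hBC))
    fun w => by
      obtain ⟨x, y, h⟩ := h.surjective_zero w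
      exact ⟨(x, y), h⟩

lemma IsMayerVietoris.finrank_zero (h : IsMayerVietoris F hIA hIB hAC hBC)
    [Module.Finite F (Homology F 0 I)] [Module.Finite F (Homology F 0 A)]
    [Module.Finite F (Homology F 0 B)] :
    Module.finrank F (Homology F 0 C) + Module.finrank F (Homology F 0 I) =
      Module.finrank F (Homology F 0 A) + Module.finrank F (Homology F 0 B) +
        kernelDim F 0 hIA hIB := by
  rw [← h.finrank_range_add, LinearMap.range_eq_top.2 fun w => ?_, finrank_top]
  obtain ⟨x, y, h⟩ := h.surjective_zero w
  exact ⟨(x, y), h⟩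

lemma IsMayerVietoris.finite_succ (h : IsMayerVietoris F hIA hIB hAC hBC) (r : ℕ)
    [Module.Finite F (Homology F r I)] [Module.Finite F (Homology F (r + 1) A)]
    [Module.Finite F (Homology F (r + 1) B)] :
    Module.Finite F (Homology F (r + 1) C) := by
  obtain ⟨δ, h1, h2⟩ := h.exists_delta r
  have hker : LinearMap.ker δ = LinearMap.range ((homologyInclusion F (r + 1) hAC).coprod
      (homologyInclusion F (r + 1) hBC)) := by
    ext w
    rw [LinearMap.mem_ker, h1]
    exact ⟨fun ⟨x, y, h⟩ => ⟨(x, y), h⟩, fun ⟨⟨x, y⟩, h⟩ => ⟨x, y, h⟩⟩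
  have : Module.Finite F (LinearMap.ker δ) := by rw [hker]; infer_instance
  have : Module.Finite F (Homology F (r + 1) C ⧸ LinearMap.ker δ) :=
    .equiv δ.quotKerEquivRange.symm
  exact Module.Finite.of_submodule_quotient (LinearMap.ker δ)

lemma IsMayerVietoris.finrank_succ (h : IsMayerVietoris F hIA hIB hAC hBC) (r : ℕ)
    [Module.Finite F (Homology F r I)] [Module.Finite F (Homology F (r + 1) I)]
    [Module.Finite F (Homology F (r + 1) A)] [Module.Finite F (Homology F (r + 1) B)] :
    Module.finrank F (Homology F (r + 1) C) + Module.finrank F (Homology F (r + 1) I) =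
      Module.finrank F (Homology F (r + 1) A) + Module.finrank F (Homology F (r + 1) B) +
        kernelDim F (r + 1) hIA hIB + kernelDim F r hIA hIB := by
  have := h.finite_succ r
  obtain ⟨δ, h1, h2⟩ := h.exists_delta r
  have hker : LinearMap.ker δ = LinearMap.range ((homologyInclusion F (r + 1) hAC).coprod
      (homologyInclusion F (r + 1) hBC)) := by
    ext w
    rw [LinearMap.mem_ker, h1]
    exact ⟨fun ⟨x, y, h⟩ => ⟨(x, y), h⟩, fun ⟨⟨x, y⟩, h⟩ => ⟨x, y, h⟩⟩
  have hrange : LinearMap.range δ = LinearMap.ker (homologyInclusion F r hIA) ⊓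
      LinearMap.ker (homologyInclusion F r hIB) := by
    ext z
    exact (h2 z).symm
  have h3 := δ.finrank_range_add_finrank_ker
  have h4 := h.finrank_range_add (r + 1)
  rw [hker, hrange] at h3
  rw [← h4]
  unfold kernelDim
  omega

/-- The kernel of `H_r(A) → H_r(C)` is the image of the kernel of `H_r(I) → H_r(B)`. -/
lemma IsMayerVietoris.finrank_ker (h : IsMayerVietoris F hIA hIB hAC hBC) (r : ℕ)
    [Module.Finite F (Homology F r I)] :
    Module.finrank F (LinearMap.ker (homologyInclusion F r hAC)) + kernelDim F r hIA hIB =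
      Module.finrank F (LinearMap.ker (homologyInclusion F r hIB)) := by
  let N := LinearMap.ker (homologyInclusion F r hIB)
  let q := (homologyInclusion F r hIA).domRestrict N
  have hrange : LinearMap.range q = LinearMap.ker (homologyInclusion F r hAC) := by
    ext x
    constructor
    · rintro ⟨⟨z, hz⟩, rfl⟩
      change homologyInclusion F r hAC (homologyInclusion F r hIA z) = 0
      rw [homologyInclusion_square (hIB := hIB) (hBC := hBC), LinearMap.mem_ker.1 hz, map_zero]
    · intro hx
      obtain ⟨z, h1, h2⟩ := h.exact_sum r x 0 ((LinearMap.mem_ker.1 hx).trans (map_zero _).symm)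
      exact ⟨⟨z, h2⟩, h1⟩
  have hker : (LinearMap.ker q).map N.subtype = LinearMap.ker (homologyInclusion F r hIA) ⊓ N := by
    ext z
    constructor
    · rintro ⟨⟨z, hz⟩, h1, rfl⟩
      exact ⟨h1, hz⟩
    · rintro ⟨h1, hz⟩
      exact ⟨⟨z, hz⟩, h1, rfl⟩
  have h1 := q.finrank_range_add_finrank_ker
  rw [hrange, (Submodule.equivMapOfInjective _ N.injective_subtype (LinearMap.ker q)).finrank_eq,
    hker] at h1
  exact h1

end Dimensions

/-! ### Level persistence numbers and persistence numbers -/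

section TameSequences

variable {F : Type u} [Field F] {X Y : Type u} [TopologicalSpace X] [TopologicalSpace Y]
  {f : X → ℝ} {g : Y → ℝ} {T : Set ℝ} {k : ℕ} {s s' : ℕ → ℝ}

lemma inclusionKernel_of_subset (r : ℕ) {A B : Set X} (h : A ⊆ B) :
    inclusionKernel F r A B = LinearMap.ker (homologyInclusion F r h) :=
  dif_pos h

lemma levelKerUp_sub (r : ℕ) {a b : ℝ} (h : a ≤ b) : levelKerUp F f r a (b - a) =
    LinearMap.ker (homologyInclusion F r (level_subset_interlevel f le_rfl h)) := by
  rw [levelKerUp, add_sub_cancel, inclusionKernel_of_subset]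

lemma levelKerDown_sub (r : ℕ) {a b : ℝ} (h : a ≤ b) : levelKerDown F f r b (b - a) =
    LinearMap.ker (homologyInclusion F r (level_subset_interlevel f h le_rfl)) := by
  rw [levelKerDown, sub_sub_cancel, inclusionKernel_of_subset]

lemma levelBothDim_sub (r : ℕ) {a b c : ℝ} (hab : a ≤ b) (hbc : b ≤ c) :
    levelBothDim F f r b (b - a) (c - b) =
      kernelDim F r (level_subset_interlevel f hab le_rfl)
        (level_subset_interlevel f le_rfl hbc) := by
  rw [levelBothDim, levelKerDown_sub r hab, levelKerUp_sub r hbc, kernelDim]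

lemma IsTameSequence.le (hf : IsTameSequence f k s) {i j : ℕ} (hi : 1 ≤ i) (hij : i ≤ j)
    (hj : j ≤ 2 * k + 1) : s i ≤ s j :=
  hf.strictMonoOn.monotoneOn ⟨hi, hij.trans hj⟩ ⟨hi.trans hij, hj⟩ hij

/-- The interlevel between two consecutive values is homologically equivalent to the one of its two
boundary levels that has even index, the only one that may be critical. Its index is written
`2 * ((i + 1) / 2)`, with integer division. -/
lemma IsTameSequence.isHomologyEquiv (hf : IsTameSequence f k s) {i : ℕ} (hi : 1 ≤ i)
    (hik : i + 1 ≤ 2 * k + 1) :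
    IsHomologyEquiv F (level f (s (2 * ((i + 1) / 2)))) (interlevel f (s i) (s (i + 1))) := by
  have ht := hf.tame.isHomologicallyTame F
  have hle := hf.le hi (Nat.le_add_right i 1) hik
  have hmem : ∀ {j}, 1 ≤ j → j ≤ k → 2 * j ∈ Icc 1 (2 * k + 1) := fun h1 h2 => ⟨by omega, by omega⟩
  rcases Nat.even_or_odd' i with ⟨m, rfl | rfl⟩
  · rw [show (2 * m + 1) / 2 = m by omega]
    refine ht.isHomologyEquiv_right hle ?_
    rintro _ ⟨h1, h2⟩ ⟨j, hj, rfl⟩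
    rw [hf.strictMonoOn.lt_iff_lt ⟨hi, by omega⟩ (hmem hj.1 hj.2)] at h1
    rw [hf.strictMonoOn.le_iff_le (hmem hj.1 hj.2) ⟨by omega, hik⟩] at h2
    omega
  · rw [show 2 * ((2 * m + 1 + 1) / 2) = 2 * m + 1 + 1 by omega]
    refine ht.isHomologyEquiv_left hle ?_
    rintro _ ⟨h1, h2⟩ ⟨j, hj, rfl⟩
    rw [hf.strictMonoOn.le_iff_le ⟨hi, by omega⟩ (hmem hj.1 hj.2)] at h1
    rw [hf.strictMonoOn.lt_iff_lt (hmem hj.1 hj.2) ⟨by omega, hik⟩] at h2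
    omega

lemma IsTameSequence.isMayerVietoris (hf : IsTameSequence f k s) {h i j : ℕ} (h1 : 1 ≤ h)
    (hhi : h ≤ i) (hij : i ≤ j) (hj : j ≤ 2 * k + 1) :
    IsMayerVietoris F (level_subset_interlevel f (hf.le h1 hhi (hij.trans hj)) le_rfl)
      (level_subset_interlevel f le_rfl (hf.le (h1.trans hhi) hij hj))
      (interlevel_mono f le_rfl (hf.le (h1.trans hhi) hij hj))
      (interlevel_mono f (hf.le h1 hhi (hij.trans hj)) le_rfl) :=
  (hf.tame.isHomologicallyTame F).isMayerVietoris (hf.le h1 hhi (hij.trans hj))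
    (hf.le (h1.trans hhi) hij hj)

/-- The first and the last value of the sequence bound the function, since its extreme values are
critical. -/
lemma IsTameSequence.mem_Icc [CompactSpace X] (hf : IsTameSequence f k s) (x : X) :
    f x ∈ Icc (s 1) (s (2 * k + 1)) := by
  obtain ⟨⟨_, ⟨i, hi, rfl⟩, h1⟩, _, ⟨j, hj, rfl⟩, h2⟩ := hf.tame.exists_mem_bounds x
  obtain ⟨hi1, hi2⟩ := hi
  obtain ⟨hj1, hj2⟩ := hj
  exact ⟨(hf.le le_rfl (by omega) (by omega)).trans h1,
    h2.trans (hf.le (by omega) (by omega) le_rfl)⟩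

lemma IsTameSequence.sublevel_eq [CompactSpace X] (hf : IsTameSequence f k s) (t : ℝ) :
    sublevel f t = interlevel f (s 1) t := by
  ext x
  exact ⟨fun h => ⟨(hf.mem_Icc x).1, h⟩, fun h => h.2⟩

lemma IsTameSequence.sublevel_neg_eq [CompactSpace X] (hf : IsTameSequence f k s) (t : ℝ) :
    sublevel (fun x => -f x) (-t) = interlevel f t (s (2 * k + 1)) := by
  ext x
  exact ⟨fun h => ⟨neg_le_neg_iff.1 h, (hf.mem_Icc x).2⟩, fun h => neg_le_neg h.1⟩

/-- The dimensions of the homology of the interlevels are determined by the numbers `l_r` and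
`e_r`. -/
theorem finrank_interlevel_eq (hf : IsTameSequence f k s) (hg : IsTameSequence g k s')
    (hfin_f : ∀ (r : ℕ) (t : ℝ), Module.Finite F (Homology F r (level f t)))
    (hfin_g : ∀ (r : ℕ) (t : ℝ), Module.Finite F (Homology F r (level g t)))
    (hl : ∀ r i : ℕ, 1 ≤ i → i ≤ 2 * k + 1 →
      levelDim F f r (s i) = levelDim F g r (s' i))
    (he : ∀ r h i j : ℕ, 1 ≤ h → h ≤ i → i ≤ j → j ≤ 2 * k + 1 →
      levelBothDim F f r (s i) (s i - s h) (s j - s i) =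
        levelBothDim F g r (s' i) (s' i - s' h) (s' j - s' i))
    (r i j : ℕ) (hi : 1 ≤ i) (hij : i ≤ j) (hj : j ≤ 2 * k + 1) :
    Module.Finite F (Homology F r (interlevel f (s i) (s j))) ∧
    Module.Finite F (Homology F r (interlevel g (s' i) (s' j))) ∧
    Module.finrank F (Homology F r (interlevel f (s i) (s j))) =
      Module.finrank F (Homology F r (interlevel g (s' i) (s' j))) := by
  have hone (r i : ℕ) (hi : 1 ≤ i) (hik : i + 1 ≤ 2 * k + 1) :
      Module.Finite F (Homology F r (interlevel f (s i) (s (i + 1)))) ∧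
      Module.Finite F (Homology F r (interlevel g (s' i) (s' (i + 1)))) ∧
      Module.finrank F (Homology F r (interlevel f (s i) (s (i + 1)))) =
        Module.finrank F (Homology F r (interlevel g (s' i) (s' (i + 1)))) := by
    let ef := LinearEquiv.ofBijective _ ((hf.isHomologyEquiv (F := F) hi hik).2 r)
    let eg := LinearEquiv.ofBijective _ ((hg.isHomologyEquiv (F := F) hi hik).2 r)
    exact ⟨.equiv ef, .equiv eg, by
      rw [← ef.finrank_eq, ← eg.finrank_eq]
      exact hl r _ (by omega) (by omega)⟩
  -- cut off the last interval `[s_j, s_{j+1}]`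
  induction j, hij using Nat.le_induction generalizing r with
  | base =>
    rw [interlevel_self, interlevel_self]
    exact ⟨hfin_f r _, hfin_g r _, hl r i hi hj⟩
  | succ j hij ih =>
    have hj' : j ≤ 2 * k + 1 := by omega
    have hf1 (r) := (ih r hj').1
    have hg1 (r) := (ih r hj').2.1
    have hf2 (r) := (hone r j (by omega) hj).1
    have hg2 (r) := (hone r j (by omega) hj).2.1
    have mf := hf.isMayerVietoris (F := F) hi hij (Nat.le_add_right j 1) hj
    have mg := hg.isMayerVietoris (F := F) hi hij (Nat.le_add_right j 1) hj
    have he' (r) := he r i j (j + 1) hi hij (Nat.le_add_right j 1) hj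
    simp only [
      levelBothDim_sub _ (hf.le hi hij hj') (hf.le (hi.trans hij) (Nat.le_add_right j 1) hj),
      levelBothDim_sub _ (hg.le hi hij hj') (hg.le (hi.trans hij) (Nat.le_add_right j 1) hj)] at he'
    have e1 := (ih r hj').2.2
    have e2 := (hone r j (by omega) hj).2.2
    have e3 := hl r j (by omega) hj'
    have e4 := he' r
    rw [levelDim, levelDim] at e3
    cases r with
    | zero =>
      have ef := mf.finrank_zero
      have eg := mg.finrank_zero
      exact ⟨mf.finite_zero, mg.finite_zero, by omega⟩
    | succ r =>
      have ef := mf.finrank_succ r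
      have eg := mg.finrank_succ r
      have e5 := he' r
      exact ⟨mf.finite_succ r, mg.finite_succ r, by omega⟩

/-- The kernel of `H_r(X_{s_h,s_i}) → H_r(X_{s_h,s_j})` has dimension `l⁺_r - e_r`. -/
lemma IsTameSequence.finrank_inclusionKernel_up (hf : IsTameSequence f k s)
    (hfin : ∀ (r : ℕ) (t : ℝ), Module.Finite F (Homology F r (level f t))) (r : ℕ) {h i j : ℕ}
    (h1 : 1 ≤ h) (hhi : h ≤ i) (hij : i ≤ j) (hj : j ≤ 2 * k + 1) :
    Module.finrank F (inclusionKernel F r (interlevel f (s h) (s i)) (interlevel f (s h) (s j))) +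
      levelBothDim F f r (s i) (s i - s h) (s j - s i) = levelUpDim F f r (s i) (s j - s i) := by
  have hle := hf.le h1 hhi (hij.trans hj)
  have hle' := hf.le (h1.trans hhi) hij hj
  rw [levelBothDim_sub r hle hle', levelUpDim, levelKerUp_sub r hle',
    inclusionKernel_of_subset r (interlevel_mono f le_rfl hle')]
  exact (hf.isMayerVietoris h1 hhi hij hj).finrank_ker r

/-- The kernel of `H_r(X_{s_i,s_j}) → H_r(X_{s_h,s_j})` has dimension `l⁻_r - e_r`. -/
lemma IsTameSequence.finrank_inclusionKernel_down (hf : IsTameSequence f k s)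
    (hfin : ∀ (r : ℕ) (t : ℝ), Module.Finite F (Homology F r (level f t))) (r : ℕ) {h i j : ℕ}
    (h1 : 1 ≤ h) (hhi : h ≤ i) (hij : i ≤ j) (hj : j ≤ 2 * k + 1) :
    Module.finrank F (inclusionKernel F r (interlevel f (s i) (s j)) (interlevel f (s h) (s j))) +
      levelBothDim F f r (s i) (s i - s h) (s j - s i) = levelDownDim F f r (s i) (s i - s h) := by
  have hle := hf.le h1 hhi (hij.trans hj)
  have hle' := hf.le (h1.trans hhi) hij hj
  rw [levelBothDim_sub r hle hle', levelDownDim, levelKerDown_sub r hle,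
    inclusionKernel_of_subset r (interlevel_mono f hle le_rfl), kernelDim, inf_comm]
  exact (hf.isMayerVietoris h1 hhi hij hj).symm.finrank_ker r

end TameSequences

end

end LevelPersistence

/-- Let `f` and `g` be tame functions on compact spaces, with the same number `k` of critical
values, and whose levels have finite-dimensional homology.

If the numbers `l_r` and `e_r` of `f` and `g` agree, then so do all `dim H_r(X_{s_i,s_j})`. If also
the numbers `l⁺_r` agree, then so do the persistence numbers of `f` and `g`; if also the numbers
`l⁻_r` agree, then so do the persistence numbers of `-f` and `-g`. All these dimensions are
finite. -/
theorem mainTheorem2 {F X Y : Type u} [Field F]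
    [TopologicalSpace X] [CompactSpace X] [TopologicalSpace Y] [CompactSpace Y]
    (f : X → ℝ) (g : Y → ℝ) (k : ℕ) (s s' : ℕ → ℝ)
    (hf : IsTameSequence f k s)
    (hg : IsTameSequence g k s')
    (hfin_f : ∀ (r : ℕ) (t : ℝ),
      Module.Finite F (Homology F r (level f t)))
    (hfin_g : ∀ (r : ℕ) (t : ℝ),
      Module.Finite F (Homology F r (level g t)))
    -- the numbers `l_r(s_i)` agree
    (hl : ∀ r i : ℕ, 1 ≤ i → i ≤ 2 * k + 1 →
      levelDim F f r (s i) = levelDim F g r (s' i))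
    -- the numbers `e_r(s_i; s_i - s_h, s_j - s_i)` agree
    (he : ∀ r h i j : ℕ, 1 ≤ h → h ≤ i → i ≤ j → j ≤ 2 * k + 1 →
      levelBothDim F f r (s i) (s i - s h) (s j - s i) =
        levelBothDim F g r (s' i) (s' i - s' h) (s' j - s' i)) :
    -- the dimensions of the homology of all interlevels
    (∀ r i j : ℕ, 1 ≤ i → i ≤ j → j ≤ 2 * k + 1 →
      Module.Finite F
        (Homology F r (interlevel f (s i) (s j))) ∧
      Module.Finite F
        (Homology F r (interlevel g (s' i) (s' j))) ∧
      Module.finrank F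
          (Homology F r (interlevel f (s i) (s j))) =
        Module.finrank F
          (Homology F r (interlevel g (s' i) (s' j)))) ∧
    -- the persistence numbers of `f`
    ((∀ r i j : ℕ, 1 ≤ i → i ≤ j → j ≤ 2 * k + 1 →
        levelUpDim F f r (s i) (s j - s i) =
          levelUpDim F g r (s' i) (s' j - s' i)) →
      (∀ r i : ℕ, 1 ≤ i → i ≤ 2 * k + 1 →
        Module.Finite F
          (Homology F r (sublevel f (s i))) ∧
        Module.Finite F
          (Homology F r (sublevel g (s' i))) ∧
        persistenceDim F f r (s i) =
          persistenceDim F g r (s' i)) ∧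
      (∀ r i j : ℕ, 1 ≤ i → i ≤ j → j ≤ 2 * k + 1 →
        persistenceKerDim F f r (s i) (s j) =
          persistenceKerDim F g r (s' i) (s' j))) ∧
    -- the persistence numbers of `-f`
    ((∀ r i j : ℕ, 1 ≤ i → i ≤ j → j ≤ 2 * k + 1 →
        levelDownDim F f r (s j) (s j - s i) =
          levelDownDim F g r (s' j) (s' j - s' i)) →
      (∀ r i : ℕ, 1 ≤ i → i ≤ 2 * k + 1 →
        Module.Finite F
          (Homology F r
            (sublevel (fun x => -f x) (-s i))) ∧
        Module.Finite F
          (Homology F r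
            (sublevel (fun y => -g y) (-s' i))) ∧
        persistenceDim F (fun x => -f x) r (-s i) =
          persistenceDim F (fun y => -g y) r (-s' i)) ∧
      (∀ r i j : ℕ, 1 ≤ i → i ≤ j → j ≤ 2 * k + 1 →
        persistenceKerDim F (fun x => -f x) r (-s j) (-s i) =
          persistenceKerDim F (fun y => -g y) r (-s' j) (-s' i))) := by
  have hint := finrank_interlevel_eq hf hg hfin_f hfin_g hl he
  refine ⟨hint, fun hup => ⟨fun r i hi hik => ?_, fun r i j hi hij hj => ?_⟩,
    fun hdown => ⟨fun r i hi hik => ?_, fun r i j hi hij hj => ?_⟩⟩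
  · rw [persistenceDim, persistenceDim, hf.sublevel_eq, hg.sublevel_eq]
    exact hint r 1 i le_rfl hi hik
  · rw [persistenceKerDim, persistenceKerDim, hf.sublevel_eq, hg.sublevel_eq, hf.sublevel_eq,
      hg.sublevel_eq]
    have h1 := hf.finrank_inclusionKernel_up hfin_f r le_rfl hi hij hj
    have h2 := hg.finrank_inclusionKernel_up hfin_g r le_rfl hi hij hj
    have h3 := he r 1 i j le_rfl hi hij hj
    have h4 := hup r i j hi hij hj
    omega
  · rw [persistenceDim, persistenceDim, hf.sublevel_neg_eq, hg.sublevel_neg_eq]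
    exact hint r i (2 * k + 1) hi hik le_rfl
  · rw [persistenceKerDim, persistenceKerDim, hf.sublevel_neg_eq, hg.sublevel_neg_eq,
      hf.sublevel_neg_eq, hg.sublevel_neg_eq]
    have h1 := hf.finrank_inclusionKernel_down hfin_f r hi hij hj le_rfl
    have h2 := hg.finrank_inclusionKernel_down hfin_g r hi hij hj le_rfl
    have h3 := he r i j (2 * k + 1) hi hij hj le_rfl
    have h4 := hdown r i j hi hij hj
    omega
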